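/- Let $(B_t)_{0\le t\le 1}$ be a standard $d$-dimensional Brownian motion started at the origin. For $\sigma>0$ and $y\in\mathbb{R}^d$ put $g_\sigma(y)=\exp\left(-\frac{|y|^2}{2\sigma^2}\right)$, where $|\cdot|$ is the Euclidean norm, and let $$S_\sigma=\int_0^1\int_0^1 g_\sigma(B_{t_1}-B_{t_2})\,dt_1\,dt_2 .$$ If $d\ge 3$, then, almost surely, $$\frac{S_\sigma}{\sigma^2}\longrightarrow\frac{4}{d-2}\qquad\text{as }\sigma\downarrow 0 .$$ If $d=2$, then, almost surely, $$\frac{S_\sigma}{\sigma^2\log\frac1\sigma}\longrightarrow 4\qquad\text{as }\sigma\downarrow 0 .$$ -/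

import Mathlib

open MeasureTheory ProbabilityTheory Filter
open scoped Topology

/-- `B` is a standard `d`-dimensional Brownian motion `(B_t)`, `0 ≤ t ≤ 1`, started at the origin
and defined on the probability space `(Ω, P)`: it starts at `0`, its increments over successive
time intervals are independent, `B_t - B_s` is a centred Gaussian vector with covariance matrix
`(t - s) I_d` for `s ≤ t`, and almost every path is continuous. -/
structure IsStandardBrownianMotion {Ω : Type*} [MeasurableSpace Ω] {d : ℕ}
    (B : unitInterval → Ω → EuclideanSpace ℝ (Fin d)) (P : Measure Ω) : Prop where
  start_zero : ∀ᵐ ω ∂P, B 0 ω = 0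
  indep_increments : HasIndepIncrements B P
  law_increment : ∀ s t : unitInterval, s ≤ t →
    HasLaw (fun ω => B t ω - B s ω)
      (multivariateGaussian 0 (((t : ℝ) - (s : ℝ)) • (1 : Matrix (Fin d) (Fin d) ℝ))) P
  continuous_paths : ∀ᵐ ω ∂P, Continuous (fun t => B t ω)

/-- The Gaussian kernel `g_σ(y) = exp(-|y|² / (2σ²))` (Euclidean norm, not normalized). -/
noncomputable def gaussKernel {d : ℕ} (σ : ℝ) (y : EuclideanSpace ℝ (Fin d)) : ℝ :=
  Real.exp (-‖y‖ ^ 2 / (2 * σ ^ 2))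

/-- The approximate self-intersections
`S_σ(ω) = ∫₀¹ ∫₀¹ g_σ(B_{t₁}(ω) - B_{t₂}(ω)) dt₂ dt₁`;
the measure on the unit interval is Lebesgue measure. -/
noncomputable def approxSelfIntersections {Ω : Type*} {d : ℕ}
    (B : unitInterval → Ω → EuclideanSpace ℝ (Fin d)) (σ : ℝ) (ω : Ω) : ℝ :=
  ∫ t₁ : unitInterval, ∫ t₂ : unitInterval, gaussKernel σ (B t₁ ω - B t₂ ω)

open scoped RealInnerProductSpace

/-! The proof is a second moment argument along a sequence of scales, followed by interpolation. Put
`e = σ²` and `p = d/2`. Since `g_σ` is the characteristic function of a Gaussian, Fubini turns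
expectations of one or two kernels at Brownian increments into Gaussian integrals: `E g_σ(B_t - B_s)
= (1 + |t-s|/e)^(-p)`, and two kernels give a 2×2 determinant to the power `-p`. Integrating the
first formula gives the asymptotics of the mean, `4σ²/(d-2)` for `d ≥ 3` and `4σ² log(1/σ)` for `d =
2`.

For the variance, let two time intervals have rescaled lengths `a`, `b` and overlap `c`. Their
covariance is `D^(-p) - (D + c²)^(-p)` with `D = (1+a)(1+b) - c²`. By `overlap_rpow_neg_sub_le` it
is at most `p` times a product of three kernels `(1 + |u|)^(-β)`, one for the length of the first
interval and one for each pair of corresponding endpoints, provided `β ≤ (p+1)/3`. This product is a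
path on the four times, so integrating its leaves first bounds the variance by a constant times
`(e^β)^3 = σ^(6β)`, if `0 ≤ β < 1`. Relative to the squared normalization this is `1/log²(1/σ)` for
`d = 2`, `β = 2/3`, and `σ` for `d ≥ 3`, `β = 5/6`.

At `σ_n = exp(-n^(2/3))` these bounds are `O(n^(-4/3))`, hence summable, and almost sure convergence
holds along `σ_n`. Because `S_σ` increases with `σ` and `σ_n/σ_(n+1) → 1`, it extends to all `σ ↓
0`. -/

/-! ### Gaussian integrals and the kernel as a characteristic function -/

theorem stdGaussian_eq_withDensity (d : ℕ) :
    stdGaussian (EuclideanSpace ℝ (Fin d)) =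
      volume.withDensity (fun x => ENNReal.ofReal
        ((2 * Real.pi) ^ (-(d : ℝ) / 2) * Real.exp (-(1 / 2) * ‖x‖ ^ 2))) := by
  have hpi : (0 : ℝ) < 2 * Real.pi := by positivity
  have hint : Integrable (fun x : EuclideanSpace ℝ (Fin d) =>
      (2 * Real.pi) ^ (-(d : ℝ) / 2) * Real.exp (-(1 / 2) * ‖x‖ ^ 2)) := by
    refine Integrable.const_mul ?_ _
    have := (GaussianFourier.integrable_cexp_neg_mul_sq_norm_add
      (V := EuclideanSpace ℝ (Fin d)) (b := (1 / 2 : ℂ)) (by norm_num) 0 0).re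
    refine this.congr (Eventually.of_forall fun x => ?_)
    have e : Complex.exp (-(1 / 2) * (‖x‖ : ℂ) ^ 2 +
        0 * ((⟪(0 : EuclideanSpace ℝ (Fin d)), x⟫ : ℝ) : ℂ)) =
        ((Real.exp (-(1 / 2) * ‖x‖ ^ 2) : ℝ) : ℂ) := by
      push_cast
      congr 1
      ring
    change (Complex.exp _).re = _
    exact (congrArg Complex.re e).trans (Complex.ofReal_re _)
  have : IsFiniteMeasure ((volume : Measure (EuclideanSpace ℝ (Fin d))).withDensity
      (fun x => ENNReal.ofReal
        ((2 * Real.pi) ^ (-(d : ℝ) / 2) * Real.exp (-(1 / 2) * ‖x‖ ^ 2)))) :=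
    isFiniteMeasure_withDensity_ofReal hint.2
  apply Measure.ext_of_charFun
  ext t
  rw [charFun_stdGaussian, charFun_apply, integral_withDensity_eq_integral_toReal_smul
    (by fun_prop) (Eventually.of_forall fun _ => ENNReal.ofReal_lt_top)]
  have h := GaussianFourier.integral_cexp_neg_mul_sq_norm_add
    (V := EuclideanSpace ℝ (Fin d)) (b := (1 / 2 : ℂ)) (by norm_num) Complex.I t
  have h2 : ∀ x : EuclideanSpace ℝ (Fin d), (ENNReal.ofReal
        ((2 * Real.pi) ^ (-(d : ℝ) / 2) * Real.exp (-(1 / 2) * ‖x‖ ^ 2))).toReal •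
        Complex.exp (⟪x, t⟫ * Complex.I) =
      (((2 * Real.pi) ^ (-(d : ℝ) / 2) : ℝ) : ℂ) *
        Complex.exp (-(1 / 2) * ‖x‖ ^ 2 + Complex.I * ⟪t, x⟫) := by
    intro x
    rw [ENNReal.toReal_ofReal (by positivity), Complex.real_smul, Complex.exp_add]
    push_cast
    rw [real_inner_comm, mul_comm Complex.I]
    ring
  simp_rw [h2]
  rw [integral_const_mul, h]
  have h3 : (Real.pi / (1 / 2 : ℂ)) ^ ((Module.finrank ℝ (EuclideanSpace ℝ (Fin d)) : ℂ) / 2) =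
      (((2 * Real.pi) ^ ((d : ℝ) / 2) : ℝ) : ℂ) := by
    rw [Complex.ofReal_cpow hpi.le]
    push_cast
    congr 1
    · ring
    · simp
  rw [h3, ← mul_assoc, ← Complex.ofReal_mul, ← Real.rpow_add hpi]
  simp only [Complex.I_sq]
  rw [show -(d : ℝ) / 2 + d / 2 = 0 by ring]
  simp
  congr 1
  ring

theorem integral_stdGaussian {d : ℕ} (f : EuclideanSpace ℝ (Fin d) → ℝ) :
    ∫ x, f x ∂(stdGaussian (EuclideanSpace ℝ (Fin d))) =
      (2 * Real.pi) ^ (-(d : ℝ) / 2) * ∫ x, Real.exp (-(1 / 2) * ‖x‖ ^ 2) * f x := by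
  rw [stdGaussian_eq_withDensity, integral_withDensity_eq_integral_toReal_smul
    (by fun_prop) (Eventually.of_forall fun _ => ENNReal.ofReal_lt_top), ← integral_const_mul]
  congr 1 with x
  rw [ENNReal.toReal_ofReal (by positivity), smul_eq_mul, mul_assoc]

theorem integral_exp_quadratic_stdGaussian {d : ℕ} {b : ℝ} (hb : -1 < b)
    (w : EuclideanSpace ℝ (Fin d)) :
    ∫ x, Real.exp (-(b / 2) * ‖x‖ ^ 2 + ⟪w, x⟫) ∂(stdGaussian (EuclideanSpace ℝ (Fin d))) =
      (1 + b) ^ (-(d : ℝ) / 2) * Real.exp (‖w‖ ^ 2 / (2 * (1 + b))) := by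
  have hpi : (0 : ℝ) < 2 * Real.pi := by positivity
  have hb' : 0 < 1 + b := by linarith
  rw [integral_stdGaussian]
  have h := GaussianFourier.integral_cexp_neg_mul_sq_norm_add
    (V := EuclideanSpace ℝ (Fin d)) (b := (((1 + b) / 2 : ℝ) : ℂ))
    (by rw [Complex.ofReal_re]; positivity) 1 w
  have h1 : ∀ x : EuclideanSpace ℝ (Fin d),
      Complex.exp (-(((1 + b) / 2 : ℝ) : ℂ) * ‖x‖ ^ 2 + 1 * ⟪w, x⟫) =
      ((Real.exp (-(1 / 2) * ‖x‖ ^ 2) * Real.exp (-(b / 2) * ‖x‖ ^ 2 + ⟪w, x⟫) : ℝ) : ℂ) := by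
    intro x
    rw [← Real.exp_add]
    push_cast
    congr 1
    ring
  simp_rw [h1] at h
  rw [integral_complex_ofReal] at h
  have h3 : (Real.pi / (((1 + b) / 2 : ℝ) : ℂ)) ^
      ((Module.finrank ℝ (EuclideanSpace ℝ (Fin d)) : ℂ) / 2) =
      (((2 * Real.pi / (1 + b)) ^ ((d : ℝ) / 2) : ℝ) : ℂ) := by
    rw [Complex.ofReal_cpow (by positivity)]
    push_cast
    congr 1
    · field_simp
    · simp
  have h4 : Complex.exp (1 ^ 2 * (‖w‖ : ℂ) ^ 2 / (4 * (((1 + b) / 2 : ℝ) : ℂ))) =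
      ((Real.exp (‖w‖ ^ 2 / (2 * (1 + b))) : ℝ) : ℂ) := by
    push_cast
    congr 1
    have : (1 + b : ℂ) ≠ 0 := by exact_mod_cast hb'.ne'
    field_simp
    ring
  rw [h3, h4, ← Complex.ofReal_mul, Complex.ofReal_inj] at h
  rw [h, ← mul_assoc, Real.div_rpow hpi.le hb'.le, neg_div, Real.rpow_neg hpi.le,
    Real.rpow_neg hb'.le]
  have := (Real.rpow_pos_of_pos hpi ((d : ℝ) / 2)).ne'
  field_simp

theorem gaussKernel_eq_charFun {d : ℕ} (σ : ℝ) (y : EuclideanSpace ℝ (Fin d)) :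
    (gaussKernel σ y : ℂ) = charFun (stdGaussian (EuclideanSpace ℝ (Fin d))) (σ⁻¹ • y) := by
  rw [charFun_stdGaussian, gaussKernel]
  push_cast
  rw [norm_smul]
  congr 1
  have h : ((|σ⁻¹| * ‖y‖) ^ 2 : ℝ) = σ⁻¹ ^ 2 * ‖y‖ ^ 2 := by rw [mul_pow, sq_abs]
  rw [Real.norm_eq_abs, ← Complex.ofReal_pow (|σ⁻¹| * ‖y‖), h]
  push_cast
  ring

/-- Write both kernels as characteristic functions of independent standard Gaussians `ξ`, `η` and
exchange the integrals; the joint characteristic function of `(U, V)` then leaves a Gaussian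
integral in `(ξ, η)`. Assuming only that characteristic function allows a degenerate pair `(U, V)`.
-/
theorem integral_gaussKernel_mul {Ω : Type*} [MeasurableSpace Ω] {P : Measure Ω}
    [IsProbabilityMeasure P] {d : ℕ} {U V : Ω → EuclideanSpace ℝ (Fin d)}
    (hU : AEMeasurable U P) (hV : AEMeasurable V P) {a b c σ : ℝ} (hσ : 0 < σ)
    (ha : 0 ≤ a) (hb : 0 ≤ b) (hc : c ^ 2 ≤ a * b)
    (h : ∀ ξ η : EuclideanSpace ℝ (Fin d),
      ∫ ω, Complex.exp ((⟪ξ, U ω⟫ + ⟪η, V ω⟫ : ℝ) * Complex.I) ∂P =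
        (Real.exp (-(1 / 2) * (a * ‖ξ‖ ^ 2 + 2 * c * ⟪ξ, η⟫ + b * ‖η‖ ^ 2)) : ℝ)) :
    ∫ ω, gaussKernel σ (U ω) * gaussKernel σ (V ω) ∂P =
      ((1 + a / σ ^ 2) * (1 + b / σ ^ 2) - (c / σ ^ 2) ^ 2) ^ (-(d : ℝ) / 2) := by
  set γ := stdGaussian (EuclideanSpace ℝ (Fin d)) with hγ
  have hk : ∀ ω, ((gaussKernel σ (U ω) * gaussKernel σ (V ω) : ℝ) : ℂ) =
      ∫ p : EuclideanSpace ℝ (Fin d) × EuclideanSpace ℝ (Fin d),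
        Complex.exp ((⟪σ⁻¹ • p.1, U ω⟫ + ⟪σ⁻¹ • p.2, V ω⟫ : ℝ) * Complex.I) ∂(γ.prod γ) := by
    intro ω
    push_cast
    rw [gaussKernel_eq_charFun, gaussKernel_eq_charFun, charFun_apply, charFun_apply,
      ← integral_prod_mul]
    congr 1 with p
    rw [← Complex.exp_add]
    simp only [real_inner_smul_left, real_inner_smul_right]
    ring_nf
  have hbβ : -1 < b / σ ^ 2 := by have : 0 ≤ b / σ ^ 2 := by positivity
                                  linarith
  have hA : 0 < 1 + a / σ ^ 2 := by positivity
  have hB : 0 < 1 + b / σ ^ 2 := by positivity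
  have hcs : (c / σ ^ 2) ^ 2 ≤ (a / σ ^ 2) * (b / σ ^ 2) := by
    rw [div_pow, div_mul_div_comm, ← sq]
    gcongr
  have hD : 0 < (1 + a / σ ^ 2) * (1 + b / σ ^ 2) - (c / σ ^ 2) ^ 2 := by
    have h1 : 0 ≤ a / σ ^ 2 := by positivity
    have h2 : 0 ≤ b / σ ^ 2 := by positivity
    nlinarith
  have hmeas : AEStronglyMeasurable (Function.uncurry fun ω
      (p : EuclideanSpace ℝ (Fin d) × EuclideanSpace ℝ (Fin d)) =>
      Complex.exp ((⟪σ⁻¹ • p.1, U ω⟫ + ⟪σ⁻¹ • p.2, V ω⟫ : ℝ) * Complex.I))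
      (P.prod (γ.prod γ)) := by
    have hU' : AEMeasurable (fun q : Ω × (EuclideanSpace ℝ (Fin d) × EuclideanSpace ℝ (Fin d)) =>
      U q.1) (P.prod (γ.prod γ)) := hU.comp_fst
    have hV' : AEMeasurable (fun q : Ω × (EuclideanSpace ℝ (Fin d) × EuclideanSpace ℝ (Fin d)) =>
      V q.1) (P.prod (γ.prod γ)) := hV.comp_fst
    refine AEMeasurable.aestronglyMeasurable ?_
    unfold Function.uncurry
    fun_prop
  have key : ((∫ ω, gaussKernel σ (U ω) * gaussKernel σ (V ω) ∂P : ℝ) : ℂ) =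
      ((∫ p : EuclideanSpace ℝ (Fin d) × EuclideanSpace ℝ (Fin d),
        Real.exp (-(1 / 2) * (a / σ ^ 2 * ‖p.1‖ ^ 2 + 2 * (c / σ ^ 2) * ⟪p.1, p.2⟫ +
          b / σ ^ 2 * ‖p.2‖ ^ 2)) ∂(γ.prod γ) : ℝ) : ℂ) := by
    rw [← integral_complex_ofReal]
    simp_rw [hk]
    rw [integral_integral_swap]
    · rw [← integral_complex_ofReal]
      congr 1 with p
      rw [h]
      norm_num [norm_smul, real_inner_smul_left, real_inner_smul_right, abs_of_pos hσ]
      congr 1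
      have : (σ : ℂ) ≠ 0 := by exact_mod_cast hσ.ne'
      field_simp
    · refine Integrable.of_bound hmeas 1 (Eventually.of_forall fun q => ?_)
      simp only [Function.uncurry]
      rw [Complex.norm_exp_ofReal_mul_I]
  rw [Complex.ofReal_inj] at key
  rw [key, integral_prod]
  · have h5 : ∀ ξ : EuclideanSpace ℝ (Fin d), ∫ η, Real.exp (-(1 / 2) * (a / σ ^ 2 * ‖ξ‖ ^ 2 +
        2 * (c / σ ^ 2) * ⟪ξ, η⟫ + b / σ ^ 2 * ‖η‖ ^ 2)) ∂γ =
        (1 + b / σ ^ 2) ^ (-(d : ℝ) / 2) *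
          Real.exp (-((a / σ ^ 2 - (c / σ ^ 2) ^ 2 / (1 + b / σ ^ 2)) / 2) * ‖ξ‖ ^ 2
            + ⟪(0 : EuclideanSpace ℝ (Fin d)), ξ⟫) := by
      intro ξ
      have := integral_exp_quadratic_stdGaussian hbβ ((-(c / σ ^ 2)) • ξ)
      rw [inner_zero_left, add_zero]
      have h6 : ∀ η : EuclideanSpace ℝ (Fin d), Real.exp (-(1 / 2) * (a / σ ^ 2 * ‖ξ‖ ^ 2 +
        2 * (c / σ ^ 2) * ⟪ξ, η⟫ + b / σ ^ 2 * ‖η‖ ^ 2)) =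
        Real.exp (-(1 / 2) * (a / σ ^ 2 * ‖ξ‖ ^ 2)) *
        Real.exp (-(b / σ ^ 2 / 2) * ‖η‖ ^ 2 + ⟪(-(c / σ ^ 2)) • ξ, η⟫) := by
        intro η
        rw [← Real.exp_add, real_inner_smul_left]
        congr 1
        ring
      simp_rw [h6]
      rw [integral_const_mul, this, mul_left_comm, ← Real.exp_add]
      congr 2
      rw [norm_smul, mul_pow, Real.norm_eq_abs, sq_abs]
      field_simp
      ring
    simp_rw [h5]
    -- The Schur complement left after integrating out `η`; it is the determinant divided by `1 +
    -- b/σ²`.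
    have hx : 0 < 1 + (a / σ ^ 2 - (c / σ ^ 2) ^ 2 / (1 + b / σ ^ 2)) := by
      rw [show 1 + (a / σ ^ 2 - (c / σ ^ 2) ^ 2 / (1 + b / σ ^ 2)) =
        ((1 + a / σ ^ 2) * (1 + b / σ ^ 2) - (c / σ ^ 2) ^ 2) / (1 + b / σ ^ 2) by
          field_simp; ring]
      positivity
    rw [integral_const_mul, integral_exp_quadratic_stdGaussian (by linarith),
      norm_zero, zero_pow two_ne_zero, zero_div, Real.exp_zero, mul_one,
      ← Real.mul_rpow hB.le hx.le]
    congr 1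
    field_simp
    ring
  · refine Integrable.of_bound (by fun_prop) 1 (Eventually.of_forall fun q => ?_)
    rw [Real.norm_eq_abs, abs_of_pos (Real.exp_pos _), Real.exp_le_one_iff]
    have h7 : |(c / σ ^ 2) * ⟪q.1, q.2⟫| ≤ |c / σ ^ 2| * (‖q.1‖ * ‖q.2‖) := by
      rw [abs_mul]; gcongr; exact abs_real_inner_le_norm _ _
    have h8 : |c / σ ^ 2| * (‖q.1‖ * ‖q.2‖) ≤
        (a / σ ^ 2 * ‖q.1‖ ^ 2 + b / σ ^ 2 * ‖q.2‖ ^ 2) / 2 := by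
      have h1 : 0 ≤ a / σ ^ 2 := by positivity
      have h2 : 0 ≤ b / σ ^ 2 := by positivity
      refine le_of_sq_le_sq ?_ (by positivity)
      rw [mul_pow, sq_abs]
      calc (c / σ ^ 2) ^ 2 * (‖q.1‖ * ‖q.2‖) ^ 2
          ≤ (a / σ ^ 2 * (b / σ ^ 2)) * (‖q.1‖ * ‖q.2‖) ^ 2 := by gcongr
        _ ≤ _ := by nlinarith [sq_nonneg (a / σ ^ 2 * ‖q.1‖ ^ 2 - b / σ ^ 2 * ‖q.2‖ ^ 2)]
    have := neg_abs_le ((c / σ ^ 2) * ⟪q.1, q.2⟫)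
    nlinarith

/-! ### Moments of the kernel at Brownian increments -/

section Covariance

variable {Ω : Type*} [MeasurableSpace Ω] {P : Measure Ω} {d : ℕ}
  {B : unitInterval → Ω → EuclideanSpace ℝ (Fin d)}

theorem IsStandardBrownianMotion.integral_exp_increment [IsProbabilityMeasure P]
    (hB : IsStandardBrownianMotion B P)
    {s t : unitInterval} (hst : s ≤ t) (ξ : EuclideanSpace ℝ (Fin d)) :
    ∫ ω, Complex.exp ((⟪ξ, B t ω - B s ω⟫ : ℝ) * Complex.I) ∂P =
      (Real.exp (-(1 / 2) * (((t : ℝ) - s) * ‖ξ‖ ^ 2)) : ℝ) := by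
  have hst' : (0 : ℝ) ≤ (t : ℝ) - s := sub_nonneg.2 hst
  have hps : (((t : ℝ) - (s : ℝ)) • (1 : Matrix (Fin d) (Fin d) ℝ)).PosSemidef :=
    Matrix.PosSemidef.one.smul hst'
  have h := charFun_multivariateGaussian (μ := 0) hps ξ
  rw [← (hB.law_increment s t hst).map_eq, charFun_apply,
    integral_map (hB.law_increment s t hst).aemeasurable (by fun_prop)] at h
  simp_rw [real_inner_comm ξ] at h
  rw [h, Matrix.smul_mulVec, Matrix.one_mulVec, dotProduct_smul, EuclideanSpace.real_norm_sq_eq]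
  simp only [inner_zero_right]
  push_cast
  congr 1
  simp [dotProduct, ← sq]
  ring

/-- Two arbitrary increments are combinations of the increments over a common partition, so
independence makes the characteristic function factor over the partition. -/
theorem IsStandardBrownianMotion.integral_exp_increments [IsProbabilityMeasure P]
    (hB : IsStandardBrownianMotion B P)
    {n : ℕ} {t : Fin (n + 1) → unitInterval} (ht : Monotone t) (u v : Fin n → ℝ)
    (ξ η : EuclideanSpace ℝ (Fin d)) :
    ∫ ω, Complex.exp ((⟪ξ, ∑ i, u i • (B (t i.succ) ω - B (t i.castSucc) ω)⟫ +
        ⟪η, ∑ i, v i • (B (t i.succ) ω - B (t i.castSucc) ω)⟫ : ℝ) * Complex.I) ∂P =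
      (Real.exp (-(1 / 2) * ((∑ i, ((t i.succ : ℝ) - t i.castSucc) * u i ^ 2) * ‖ξ‖ ^ 2 +
        2 * (∑ i, ((t i.succ : ℝ) - t i.castSucc) * (u i * v i)) * ⟪ξ, η⟫ +
        (∑ i, ((t i.succ : ℝ) - t i.castSucc) * v i ^ 2) * ‖η‖ ^ 2)) : ℝ) := by
  have hle : ∀ i : Fin n, t i.castSucc ≤ t i.succ := fun i => ht (Fin.castSucc_lt_succ).le
  have h1 : ∀ ω, Complex.exp ((⟪ξ, ∑ i, u i • (B (t i.succ) ω - B (t i.castSucc) ω)⟫ +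
        ⟪η, ∑ i, v i • (B (t i.succ) ω - B (t i.castSucc) ω)⟫ : ℝ) * Complex.I) =
      ∏ i, Complex.exp ((⟪u i • ξ + v i • η, B (t i.succ) ω - B (t i.castSucc) ω⟫ : ℝ) *
        Complex.I) := by
    intro ω
    rw [← Complex.exp_sum, ← Finset.sum_mul, ← Complex.ofReal_sum]
    congr 3
    simp only [inner_sum, inner_add_left, real_inner_smul_left, real_inner_smul_right,
      Finset.sum_add_distrib]
  simp_rw [h1]
  rw [(hB.indep_increments n t ht).integral_fun_prod_comp
    (f := fun i x => Complex.exp ((⟪u i • ξ + v i • η, x⟫ : ℝ) * Complex.I))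
    (fun i => (hB.law_increment _ _ (hle i)).aemeasurable)
    (fun i => by fun_prop)]
  simp_rw [fun i => hB.integral_exp_increment (hle i) (u i • ξ + v i • η)]
  rw [← Complex.ofReal_prod, ← Real.exp_sum]
  congr 2
  rw [← Finset.mul_sum]
  congr 1
  rw [Finset.mul_sum, Finset.sum_mul, Finset.sum_mul, Finset.sum_mul, ← Finset.sum_add_distrib,
    ← Finset.sum_add_distrib]
  refine Finset.sum_congr rfl fun i _ => ?_
  rw [norm_add_sq_real, norm_smul, norm_smul, mul_pow, mul_pow, Real.norm_eq_abs,
    Real.norm_eq_abs, sq_abs, sq_abs, real_inner_smul_left, real_inner_smul_right]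
  ring

theorem IsStandardBrownianMotion.integral_gaussKernel_increments [IsProbabilityMeasure P]
    (hB : IsStandardBrownianMotion B P)
    {n : ℕ} {t : Fin (n + 1) → unitInterval} (ht : Monotone t) (u v : Fin n → ℝ)
    {σ : ℝ} (hσ : 0 < σ) :
    ∫ ω, gaussKernel σ (∑ i, u i • (B (t i.succ) ω - B (t i.castSucc) ω)) *
        gaussKernel σ (∑ i, v i • (B (t i.succ) ω - B (t i.castSucc) ω)) ∂P =
      ((1 + (∑ i, ((t i.succ : ℝ) - t i.castSucc) * u i ^ 2) / σ ^ 2) *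
        (1 + (∑ i, ((t i.succ : ℝ) - t i.castSucc) * v i ^ 2) / σ ^ 2) -
        ((∑ i, ((t i.succ : ℝ) - t i.castSucc) * (u i * v i)) / σ ^ 2) ^ 2) ^ (-(d : ℝ) / 2) := by
  have hle : ∀ i : Fin n, (0 : ℝ) ≤ (t i.succ : ℝ) - t i.castSucc :=
    fun i => sub_nonneg.2 (ht (Fin.castSucc_lt_succ).le)
  have hm : ∀ i : Fin n, AEMeasurable (fun ω => B (t i.succ) ω - B (t i.castSucc) ω) P :=
    fun i => (hB.law_increment _ _ (ht (Fin.castSucc_lt_succ).le)).aemeasurable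
  refine integral_gaussKernel_mul ?_ ?_ hσ ?_ ?_ ?_ (hB.integral_exp_increments ht u v)
  · exact Finset.aemeasurable_fun_sum _ fun i _ => by have := hm i; fun_prop
  · exact Finset.aemeasurable_fun_sum _ fun i _ => by have := hm i; fun_prop
  · exact Finset.sum_nonneg fun i _ => mul_nonneg (hle i) (sq_nonneg _)
  · exact Finset.sum_nonneg fun i _ => mul_nonneg (hle i) (sq_nonneg _)
  · refine Finset.sum_sq_le_sum_mul_sum_of_sq_le_mul _
      (fun i _ => mul_nonneg (hle i) (sq_nonneg _))
      (fun i _ => mul_nonneg (hle i) (sq_nonneg _)) fun i _ => le_of_eq (by ring)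

theorem IsStandardBrownianMotion.integral_gaussKernel_mul_gaussKernel [IsProbabilityMeasure P]
    (hB : IsStandardBrownianMotion B P)
    {σ : ℝ} (hσ : 0 < σ) {s t s' t' : unitInterval} (h : s ≤ t) (h' : s' ≤ t') :
    ∫ ω, gaussKernel σ (B t ω - B s ω) * gaussKernel σ (B t' ω - B s' ω) ∂P =
      ((1 + ((t : ℝ) - s) / σ ^ 2) * (1 + ((t' : ℝ) - s') / σ ^ 2) -
        (max 0 (min (t : ℝ) t' - max (s : ℝ) s') / σ ^ 2) ^ 2) ^ (-(d : ℝ) / 2) := by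
  wlog hss : s ≤ s' generalizing s t s' t'
  · have := this h' h (le_of_not_ge hss)
    simp_rw [mul_comm (gaussKernel σ (B t _ - B s _)), this, min_comm (t : ℝ), max_comm (s : ℝ)]
    congr 2
    ring
  have e0 : ((0 : ℝ) ≤ (t : ℝ) - s) := sub_nonneg.2 h
  have e1 : ((0 : ℝ) ≤ (t' : ℝ) - s') := sub_nonneg.2 h'
  have e2 : ((s : ℝ) ≤ s') := hss
  rw [max_eq_right e2]
  rcases le_total t s' with h1 | h1
  · have e3 : ((t : ℝ) ≤ s') := h1
    have hmono : Monotone ![s, t, s', t'] := by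
      rw [Fin.monotone_iff_le_succ]
      intro i; fin_cases i <;> simpa
    -- The 0-1 vectors mark which pieces of the partition lie in `[s, t]` and in `[s', t']`: here
    -- the intervals are disjoint, below they overlap partially, then are nested.
    have := hB.integral_gaussKernel_increments hmono ![1, 0, 0] ![0, 0, 1] hσ
    simp [Fin.sum_univ_succ] at this
    rw [min_eq_left (by linarith), max_eq_left (by linarith)]
    simpa using this
  have e3 : ((s' : ℝ) ≤ t) := h1
  rcases le_total t t' with h2 | h2
  · have e4 : ((t : ℝ) ≤ t') := h2
    have hmono : Monotone ![s, s', t, t'] := by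
      rw [Fin.monotone_iff_le_succ]
      intro i; fin_cases i <;> simpa
    have := hB.integral_gaussKernel_increments hmono ![1, 1, 0] ![0, 1, 1] hσ
    simp [Fin.sum_univ_succ] at this
    rw [min_eq_left (by linarith), max_eq_right (by linarith)]
    simpa using this
  · have e4 : ((t' : ℝ) ≤ t) := h2
    have hmono : Monotone ![s, s', t', t] := by
      rw [Fin.monotone_iff_le_succ]
      intro i; fin_cases i <;> simpa
    have := hB.integral_gaussKernel_increments hmono ![1, 1, 1] ![0, 1, 0] hσ
    simp [Fin.sum_univ_succ] at this
    rw [min_eq_right (by linarith), max_eq_right (by linarith)]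
    simpa using this

theorem IsStandardBrownianMotion.integral_gaussKernel [IsProbabilityMeasure P]
    (hB : IsStandardBrownianMotion B P)
    {σ : ℝ} (hσ : 0 < σ) (s t : unitInterval) :
    ∫ ω, gaussKernel σ (B t ω - B s ω) ∂P =
      (1 + |(t : ℝ) - s| / σ ^ 2) ^ (-(d : ℝ) / 2) := by
  wlog h : s ≤ t generalizing s t
  · have := this t s (le_of_not_ge h)
    rw [abs_sub_comm, ← this]
    simp [gaussKernel, norm_sub_rev]
  have e0 : ((0 : ℝ) ≤ (t : ℝ) - s) := sub_nonneg.2 h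
  -- The second interval is degenerate, so its kernel equals 1.
  have := hB.integral_gaussKernel_mul_gaussKernel hσ h (le_refl s)
  have e1 : min (t : ℝ) s - max (s : ℝ) s ≤ 0 := by
    rw [max_self]; linarith [min_le_right (t : ℝ) s]
  simpa [gaussKernel, max_eq_left e1, abs_of_nonneg e0] using this

end Covariance

/-! ### Deterministic bound for the covariance of two intervals -/

/-- Bernoulli's inequality for `(D/(D+q))^p = (1 - q/(D+q))^p`. -/
theorem rpow_neg_sub_rpow_neg_add_le {p D q : ℝ} (hp : 1 ≤ p) (hD : 0 < D) (hq : 0 ≤ q) :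
    D ^ (-p) - (D + q) ^ (-p) ≤ p * D ^ (-p) * (q / (D + q)) := by
  have hDq : 0 < D + q := by positivity
  have h1 : q / (D + q) ≤ 1 := by rw [div_le_one hDq]; linarith
  have h := one_add_mul_self_le_rpow_one_add (s := -(q / (D + q))) (by linarith) hp
  have h2 : 1 + -(q / (D + q)) = D / (D + q) := by field_simp; ring
  rw [h2, Real.div_rpow hD.le hDq.le] at h
  have h3 : (D + q) ^ (-p) = D ^ (-p) * (D ^ p / (D + q) ^ p) := by
    rw [Real.rpow_neg hD.le, Real.rpow_neg hDq.le]
    have := (Real.rpow_pos_of_pos hD p).ne'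
    field_simp
  rw [h3]
  have h4 : 0 < D ^ (-p) := Real.rpow_pos_of_pos hD _
  nlinarith

/-- With `γ = (p+1)/3`, keep a square root of `1+x` and of `1+z` and bound all else by powers of
`1+M`: the exponent is `γ + 2(γ - 1/2) = p`, which is where the threshold for `β` comes from.
Moreover `√((1+x)(1+z)) ≤ 1+x+z`. -/
theorem rpow_mul_rpow_mul_rpow_le {a x z M p β : ℝ} (ha0 : 0 ≤ a) (hx0 : 0 ≤ x) (hz0 : 0 ≤ z)
    (haM : a ≤ M) (hxM : x ≤ M) (hzM : z ≤ M) (hp : 1 ≤ p) (hβ : β ≤ (p + 1) / 3) :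
    (1 + a) ^ β * ((1 + x) ^ β * (1 + z) ^ β) ≤ (1 + M) ^ p * (1 + (x + z)) := by
  have hM0 : 0 ≤ M := ha0.trans haM
  set γ := (p + 1) / 3 with hγ
  have m : ∀ y : ℝ, 0 ≤ y → (1 + y) ^ β ≤ (1 + y) ^ γ := fun y hy =>
    Real.rpow_le_rpow_of_exponent_le (by linarith) hβ
  have n : ∀ y : ℝ, 0 ≤ y → y ≤ M → (1 + y) ^ γ ≤ (1 + y) ^ (1 / 2 : ℝ) * (1 + M) ^ (γ - 1 / 2) := by
    intro y hy hyM
    have : (1 + y) ^ γ = (1 + y) ^ (1 / 2 : ℝ) * (1 + y) ^ (γ - 1 / 2) := by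
      rw [← Real.rpow_add (by linarith)]; congr 1; ring
    rw [this]
    gcongr
    linarith
  have hxz : (1 + x) ^ (1 / 2 : ℝ) * (1 + z) ^ (1 / 2 : ℝ) ≤ 1 + (x + z) := by
    rw [← Real.mul_rpow (by positivity) (by positivity), ← Real.sqrt_eq_rpow]
    apply Real.sqrt_le_iff.2 ⟨by positivity, by nlinarith [mul_nonneg hx0 hz0]⟩
  calc (1 + a) ^ β * ((1 + x) ^ β * (1 + z) ^ β)
      ≤ (1 + M) ^ γ * (((1 + x) ^ (1 / 2 : ℝ) * (1 + M) ^ (γ - 1 / 2)) *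
          ((1 + z) ^ (1 / 2 : ℝ) * (1 + M) ^ (γ - 1 / 2))) := by
        gcongr
        · exact (m a ha0).trans (by gcongr)
        · exact (m x hx0).trans (n x hx0 hxM)
        · exact (m z hz0).trans (n z hz0 hzM)
    _ = (1 + M) ^ p * ((1 + x) ^ (1 / 2 : ℝ) * (1 + z) ^ (1 / 2 : ℝ)) := by
        have : (1 + M) ^ p = (1 + M) ^ γ * (1 + M) ^ (γ - 1 / 2) * (1 + M) ^ (γ - 1 / 2) := by
          rw [← Real.rpow_add (by positivity), ← Real.rpow_add (by positivity)]
          congr 1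
          rw [hγ]; ring
        rw [this]; ring
    _ ≤ _ := by gcongr

/-- Disjoint intervals contribute nothing. Otherwise, with `M = max a b` and `x`, `z` the distances
between corresponding endpoints, the difference is at most `p (1+M)^(-p) (1+x+z)⁻¹`, and this decay
is shared among `a`, `x` and `z`. -/
theorem overlap_rpow_neg_sub_le {s t s' t' p β : ℝ} (h : s ≤ t) (h' : s' ≤ t') (hp : 1 ≤ p)
    (hβ : β ≤ (p + 1) / 3) :
    ((1 + (t - s)) * (1 + (t' - s')) - max 0 (min t t' - max s s') ^ 2) ^ (-p) -
      ((1 + (t - s)) * (1 + (t' - s'))) ^ (-p) ≤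
      p * ((1 + |t - s|) ^ (-β) * ((1 + |s - s'|) ^ (-β) * (1 + |t - t'|) ^ (-β))) := by
  rcases le_or_gt (min t t' - max s s') 0 with hc | hc
  · rw [max_eq_left hc]
    simp only [ne_eq, OfNat.ofNat_ne_zero, not_false_eq_true, zero_pow, sub_zero, sub_self]
    positivity
  rw [max_eq_right hc.le]
  set a := t - s with ha
  set b := t' - s' with hb
  set c := min t t' - max s s' with hcdef
  set x := |s - s'| with hx
  set z := |t - t'| with hz
  have hx0 : 0 ≤ x := abs_nonneg _
  have hz0 : 0 ≤ z := abs_nonneg _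
  have ha0 : 0 ≤ a := sub_nonneg.2 h
  have hb0 : 0 ≤ b := sub_nonneg.2 h'
  have hca : c ≤ a := sub_le_sub (min_le_left _ _) (le_max_left _ _)
  have hcb : c ≤ b := sub_le_sub (min_le_right _ _) (le_max_right _ _)
  have hsum : a + b = x + z + 2 * c := by
    have h1 := max_sub_min_eq_abs s s'
    have h2 := max_sub_min_eq_abs t t'
    have h3 := max_add_min s s'
    have h4 := max_add_min t t'
    rw [abs_sub_comm] at h1 h2
    linarith
  set M := max a b with hM
  have haM : a ≤ M := le_max_left _ _
  have hbM : b ≤ M := le_max_right _ _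
  -- The overlap is at most the shorter of the two lengths.
  have hMab : (1 + M) * (1 + c) ≤ (1 + a) * (1 + b) := by
    rcases max_choice a b with hh | hh <;> rw [hM, hh] <;> nlinarith
  have hxzM : x + z + c ≤ a + b - c := by linarith
  have hxM : x ≤ M := by
    rcases max_cases s s' with ⟨e1, _⟩ | ⟨e1, _⟩ <;> rcases min_cases t t' with ⟨e2, _⟩ | ⟨e2, _⟩ <;>
      rcases abs_cases (s - s') with ⟨e3, _⟩ | ⟨e3, _⟩ <;> rw [e1, e2] at hcdef <;> linarith
  have hzM : z ≤ M := by
    rcases max_cases s s' with ⟨e1, _⟩ | ⟨e1, _⟩ <;> rcases min_cases t t' with ⟨e2, _⟩ | ⟨e2, _⟩ <;>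
      rcases abs_cases (t - t') with ⟨e3, _⟩ | ⟨e3, _⟩ <;> rw [e1, e2] at hcdef <;> linarith
  have hM0 : 0 ≤ M := ha0.trans haM
  set D := (1 + a) * (1 + b) - c ^ 2 with hD
  -- The difference of the two sides is `(a-c)(b-c) + c`.
  have hD1 : (1 + c) * (1 + (x + z)) ≤ D := by
    have : x + z = a + b - 2 * c := by linarith
    rw [this, hD]
    nlinarith [mul_nonneg (sub_nonneg.2 hca) (sub_nonneg.2 hcb)]
  have hD2 : 1 + M ≤ D := by
    have : M ≤ a + b - c := by rw [hM]; exact max_le (by linarith) (by linarith)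
    have h2 : 0 ≤ c * (x + z) := by positivity
    nlinarith
  have hDpos : 0 < D := by linarith
  have hAB : (1 + a) * (1 + b) = D + c ^ 2 := by rw [hD]; ring
  have hABpos : 0 < (1 + a) * (1 + b) := by positivity
  have h1 := rpow_neg_sub_rpow_neg_add_le hp hDpos (sq_nonneg c)
  rw [hAB]
  refine h1.trans ?_
  rw [← hAB, mul_assoc]
  refine mul_le_mul_of_nonneg_left ?_ (by linarith)
  have h2 : D ^ (-p) = D ^ (-(p - 1)) * D⁻¹ := by
    rw [← Real.rpow_neg_one D, ← Real.rpow_add hDpos]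
    congr 1
    ring
  have h3 : D ^ (-(p - 1)) ≤ (1 + M) ^ (-(p - 1)) :=
    Real.rpow_le_rpow_of_nonpos (by positivity) hD2 (by linarith)
  have h4 : D⁻¹ * (c ^ 2 / ((1 + a) * (1 + b))) ≤ (1 + M)⁻¹ * (1 + (x + z))⁻¹ := by
    have e1 : D⁻¹ ≤ ((1 + c) * (1 + (x + z)))⁻¹ := inv_anti₀ (by positivity) hD1
    have e2 : c ^ 2 / ((1 + a) * (1 + b)) ≤ (1 + c) / (1 + M) := by
      rw [div_le_div_iff₀ hABpos (by positivity)]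
      have : c ^ 2 ≤ (1 + c) * (1 + c) := by nlinarith
      calc c ^ 2 * (1 + M) ≤ (1 + c) * (1 + c) * (1 + M) := by gcongr
        _ = (1 + c) * ((1 + M) * (1 + c)) := by ring
        _ ≤ _ := by gcongr
    calc _ ≤ ((1 + c) * (1 + (x + z)))⁻¹ * ((1 + c) / (1 + M)) := by gcongr
      _ = _ := by field_simp
  have h5 := rpow_mul_rpow_mul_rpow_le ha0 hx0 hz0 haM hxM hzM hp hβ
  calc D ^ (-p) * (c ^ 2 / ((1 + a) * (1 + b)))
      = D ^ (-(p - 1)) * (D⁻¹ * (c ^ 2 / ((1 + a) * (1 + b)))) := by rw [h2]; ring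
    _ ≤ (1 + M) ^ (-(p - 1)) * ((1 + M)⁻¹ * (1 + (x + z))⁻¹) := by gcongr
    _ = ((1 + M) ^ p * (1 + (x + z)))⁻¹ := by
        rw [← mul_assoc, ← Real.rpow_neg_one (1 + M), ← Real.rpow_add (by positivity), mul_inv,
          ← Real.rpow_neg (by positivity)]
        congr 2
        ring
    _ ≤ ((1 + a) ^ β * ((1 + x) ^ β * (1 + z) ^ β))⁻¹ := inv_anti₀ (by positivity) h5
    _ = _ := by
        rw [abs_of_nonneg ha0, Real.rpow_neg (by positivity), Real.rpow_neg (by positivity),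
          Real.rpow_neg (by positivity), mul_inv, mul_inv]

/-- The kernel `(1 + |u| / e) ^ (-β)`. -/
noncomputable def decayKernel (e β : ℝ) (s t : unitInterval) : ℝ :=
  (1 + |(s : ℝ) - t| / e) ^ (-β)

theorem decayKernel_comm (e β : ℝ) (s t : unitInterval) :
    decayKernel e β s t = decayKernel e β t s := by
  rw [decayKernel, decayKernel, abs_sub_comm]

theorem decayKernel_pos {e : ℝ} (he : 0 < e) (β : ℝ) (s t : unitInterval) :
    0 < decayKernel e β s t := by
  unfold decayKernel; positivity

theorem continuous_decayKernel {e : ℝ} (he : 0 < e) (β : ℝ) :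
    Continuous fun q : unitInterval × unitInterval => decayKernel e β q.1 q.2 := by
  unfold decayKernel
  refine Continuous.rpow_const (by fun_prop) fun q => Or.inl ?_
  positivity

theorem gaussKernel_sub_comm {d : ℕ} (σ : ℝ) (x y : EuclideanSpace ℝ (Fin d)) :
    gaussKernel σ (x - y) = gaussKernel σ (y - x) := by
  rw [gaussKernel, gaussKernel, norm_sub_rev]

/-! ### Covariance bound for Brownian increments -/

section Covariance

variable {Ω : Type*} [MeasurableSpace Ω] {P : Measure Ω} [IsProbabilityMeasure P] {d : ℕ}
  {B : unitInterval → Ω → EuclideanSpace ℝ (Fin d)}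

theorem IsStandardBrownianMotion.integral_gaussKernel_eq_decayKernel
    (hB : IsStandardBrownianMotion B P) {σ : ℝ} (hσ : 0 < σ) (s t : unitInterval) :
    ∫ ω, gaussKernel σ (B s ω - B t ω) ∂P = decayKernel (σ ^ 2) (d / 2) s t := by
  rw [hB.integral_gaussKernel hσ, decayKernel, neg_div]

theorem IsStandardBrownianMotion.covariance_gaussKernel_le_of_le
    (hB : IsStandardBrownianMotion B P) (hd : 2 ≤ d) {σ β : ℝ} (hσ : 0 < σ)
    (hβ : β ≤ ((d : ℝ) / 2 + 1) / 3) {s t s' t' : unitInterval}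
    (h : s ≤ t) (h' : s' ≤ t') :
    ∫ ω, gaussKernel σ (B t ω - B s ω) * gaussKernel σ (B t' ω - B s' ω) ∂P -
      decayKernel (σ ^ 2) (d / 2) t s * decayKernel (σ ^ 2) (d / 2) t' s' ≤
      (d / 2 : ℝ) * (decayKernel (σ ^ 2) β t s *
        (decayKernel (σ ^ 2) β s s' * decayKernel (σ ^ 2) β t t')) := by
  have hd' : (2 : ℝ) ≤ d := by exact_mod_cast hd
  have hσ2 : 0 < σ ^ 2 := by positivity
  have e0 : ((0 : ℝ) ≤ (t : ℝ) - s) := sub_nonneg.2 h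
  have e1 : ((0 : ℝ) ≤ (t' : ℝ) - s') := sub_nonneg.2 h'
  rw [hB.integral_gaussKernel_mul_gaussKernel hσ h h']
  have key := overlap_rpow_neg_sub_le (s := s / σ ^ 2) (t := t / σ ^ 2) (s' := s' / σ ^ 2)
    (t' := t' / σ ^ 2) (p := (d : ℝ) / 2) (β := β)
    (div_le_div_of_nonneg_right h hσ2.le) (div_le_div_of_nonneg_right h' hσ2.le)
    (by linarith) hβ
  have e2 : max 0 (min (t / σ ^ 2 : ℝ) (t' / σ ^ 2) - max (s / σ ^ 2 : ℝ) (s' / σ ^ 2)) =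
      max 0 (min (t : ℝ) t' - max (s : ℝ) s') / σ ^ 2 := by
    rw [min_div_div_right hσ2.le, max_div_div_right hσ2.le, ← sub_div, ← max_div_div_right hσ2.le,
      zero_div]
  rw [e2] at key
  simp only [← sub_div, abs_div, abs_of_pos hσ2] at key
  rw [Real.mul_rpow (x := 1 + ((t : ℝ) - s) / σ ^ 2) (by positivity) (by positivity)] at key
  unfold decayKernel
  rw [abs_of_nonneg e0, abs_of_nonneg e1] at *
  rw [neg_div]
  exact key

/-- For unordered times either pairing of the endpoints may be the right one; the sum of both
products covers every case and is symmetric under exchanging the endpoints of either interval. -/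
theorem IsStandardBrownianMotion.covariance_gaussKernel_le
    (hB : IsStandardBrownianMotion B P) (hd : 2 ≤ d) {σ β : ℝ} (hσ : 0 < σ)
    (hβ : β ≤ ((d : ℝ) / 2 + 1) / 3) (s t s' t' : unitInterval) :
    ∫ ω, gaussKernel σ (B t ω - B s ω) * gaussKernel σ (B t' ω - B s' ω) ∂P -
      decayKernel (σ ^ 2) (d / 2) t s * decayKernel (σ ^ 2) (d / 2) t' s' ≤
      (d / 2 : ℝ) * (decayKernel (σ ^ 2) β t s *
        (decayKernel (σ ^ 2) β s s' * decayKernel (σ ^ 2) β t t') +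
        decayKernel (σ ^ 2) β t s *
        (decayKernel (σ ^ 2) β s t' * decayKernel (σ ^ 2) β t s')) := by
  have hσ2 : 0 < σ ^ 2 := by positivity
  wlog h : s ≤ t generalizing s t
  · have := this t s (le_of_not_ge h)
    simp_rw [gaussKernel_sub_comm σ (B s _), decayKernel_comm _ _ s t] at this
    refine this.trans (le_of_eq ?_)
    ring
  wlog h' : s' ≤ t' generalizing s' t'
  · have := this t' s' (le_of_not_ge h')
    simp_rw [gaussKernel_sub_comm σ (B s' _), decayKernel_comm _ _ s' t'] at this
    refine this.trans (le_of_eq ?_)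
    ring
  refine (hB.covariance_gaussKernel_le_of_le hd hσ hβ h h').trans ?_
  have p1 := decayKernel_pos hσ2 β t s
  have p2 := decayKernel_pos hσ2 β s t'
  have p3 := decayKernel_pos hσ2 β t s'
  have : 0 ≤ decayKernel (σ ^ 2) β t s *
        (decayKernel (σ ^ 2) β s t' * decayKernel (σ ^ 2) β t s') := by positivity
  gcongr
  linarith

end Covariance

/-! ### Variance of an average, and integrals of the decay kernel -/

theorem integral_sq_integral_sub_eq {Ω J : Type*} [MeasurableSpace Ω] [MeasurableSpace J]
    {P : Measure Ω} {μ : Measure J} [IsProbabilityMeasure P] [IsProbabilityMeasure μ]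
    {f : J → Ω → ℝ} (hf : Measurable (Function.uncurry f)) {C : ℝ} (hC : ∀ q ω, |f q ω| ≤ C) :
    ∫ ω, (∫ q, f q ω ∂μ - ∫ q, ∫ ω, f q ω ∂P ∂μ) ^ 2 ∂P =
      ∫ r : J × J, (∫ ω, f r.1 ω * f r.2 ω ∂P - (∫ ω, f r.1 ω ∂P) * ∫ ω, f r.2 ω ∂P)
        ∂(μ.prod μ) := by
  have hC' : ∀ q ω, ‖f q ω‖ ≤ C := hC
  have hfm : Measurable fun ω => ∫ q, f q ω ∂μ :=
    (hf.comp measurable_swap).stronglyMeasurable.integral_prod_right'.measurable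
  have hmm : Measurable fun q => ∫ ω, f q ω ∂P :=
    hf.stronglyMeasurable.integral_prod_right.measurable
  have hb1 : ∀ ω, ‖∫ q, f q ω ∂μ‖ ≤ C := fun ω => by
    simpa using norm_integral_le_of_norm_le_const (μ := μ) (Eventually.of_forall fun q => hC' q ω)
  have hb2 : ∀ q, ‖∫ ω, f q ω ∂P‖ ≤ C := fun q => by
    simpa using norm_integral_le_of_norm_le_const (μ := P) (Eventually.of_forall fun ω => hC' q ω)
  have hX : MemLp (fun ω => ∫ q, f q ω ∂μ) 2 P :=
    MemLp.of_bound hfm.aestronglyMeasurable C (Eventually.of_forall hb1)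
  have hmean : ∫ ω, ∫ q, f q ω ∂μ ∂P = ∫ q, ∫ ω, f q ω ∂P ∂μ := by
    rw [integral_integral_swap]
    exact Integrable.of_bound (hf.comp measurable_swap).aestronglyMeasurable C
      (Eventually.of_forall fun x => hC' _ _)
  have hvar := variance_eq_sub hX
  rw [variance_eq_integral hfm.aemeasurable, hmean] at hvar
  rw [hvar]
  have hmeas3 : Measurable fun x : Ω × (J × J) => f x.2.1 x.1 * f x.2.2 x.1 :=
    (hf.comp ((measurable_fst.comp measurable_snd).prodMk measurable_fst)).mul
      (hf.comp ((measurable_snd.comp measurable_snd).prodMk measurable_fst))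
  have hb3 : ∀ q q' ω, ‖f q ω * f q' ω‖ ≤ C * C := fun q q' ω => by
    rw [norm_mul]
    exact mul_le_mul (hC' q ω) (hC' q' ω) (norm_nonneg _) ((norm_nonneg _).trans (hC' q ω))
  have hsq : ∫ ω, (∫ q, f q ω ∂μ) ^ 2 ∂P = ∫ r : J × J, ∫ ω, f r.1 ω * f r.2 ω ∂P ∂(μ.prod μ) := by
    simp_rw [sq, ← integral_prod_mul]
    rw [integral_integral_swap]
    exact Integrable.of_bound hmeas3.aestronglyMeasurable (C * C)
      (Eventually.of_forall fun x => hb3 _ _ _)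
  have hm2 : (∫ q, ∫ ω, f q ω ∂P ∂μ) ^ 2 =
      ∫ r : J × J, (∫ ω, f r.1 ω ∂P) * ∫ ω, f r.2 ω ∂P ∂(μ.prod μ) := by
    rw [sq, ← integral_prod_mul]
  simp only [Pi.pow_apply]
  rw [hsq, hm2, integral_sub]
  · refine Integrable.of_bound (Measurable.aestronglyMeasurable ?_) (C * C)
      (Eventually.of_forall fun r => ?_)
    · exact (hmeas3.comp measurable_swap).stronglyMeasurable.integral_prod_right'.measurable
    · simpa using norm_integral_le_of_norm_le_const (μ := P)
        (Eventually.of_forall fun ω => hb3 r.1 r.2 ω)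
  · refine Integrable.of_bound (Measurable.aestronglyMeasurable ?_) (C * C)
      (Eventually.of_forall fun r => ?_)
    · exact (hmm.comp measurable_fst).mul (hmm.comp measurable_snd)
    · rw [norm_mul]
      exact mul_le_mul (hb2 _) (hb2 _) (norm_nonneg _) ((norm_nonneg _).trans (hb2 r.1))

theorem integrable_of_continuous_of_compactSpace {X : Type*} [TopologicalSpace X] [CompactSpace X]
    [MeasurableSpace X] [OpensMeasurableSpace X] {μ : Measure X} [IsFiniteMeasure μ]
    {f : X → ℝ} (hf : Continuous f) : Integrable f μ := by
  obtain ⟨C, hC⟩ := isCompact_univ.exists_bound_of_continuousOn hf.continuousOn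
  exact Integrable.of_bound hf.measurable.aestronglyMeasurable C
    (Eventually.of_forall fun x => hC x (Set.mem_univ x))

theorem integral_unitInterval_eq (f : ℝ → ℝ) :
    ∫ s : unitInterval, f s = ∫ x in (0 : ℝ)..1, f x := by
  rw [intervalIntegral.integral_of_le zero_le_one, ← integral_Icc_eq_integral_Ioc]
  exact integral_subtype measurableSet_Icc f

theorem integral_unitInterval_abs_sub {φ : ℝ → ℝ} (hφ : Continuous fun u => φ |u|)
    (t : unitInterval) :
    ∫ s : unitInterval, φ |(t : ℝ) - s| =
      (∫ u in (0 : ℝ)..t, φ u) + ∫ u in (0 : ℝ)..(1 - t), φ u := by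
  have hc : Continuous fun u : ℝ => φ |(t : ℝ) - u| :=
    hφ.comp (by fun_prop : Continuous fun u : ℝ => (t : ℝ) - u)
  rw [integral_unitInterval_eq (fun x => φ |(t : ℝ) - x|),
    ← intervalIntegral.integral_add_adjacent_intervals (b := (t : ℝ))
      (hc.intervalIntegrable _ _) (hc.intervalIntegrable _ _)]
  congr 1
  · rw [intervalIntegral.integral_comp_sub_left (fun x => φ |x|)]
    simp only [sub_self, sub_zero]
    refine intervalIntegral.integral_congr fun u hu => ?_
    rw [Set.uIcc_of_le t.2.1] at hu
    simp only [abs_of_nonneg hu.1]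
  · simp_rw [abs_sub_comm (t : ℝ)]
    rw [intervalIntegral.integral_comp_sub_right (fun x => φ |x|)]
    simp only [sub_self]
    refine intervalIntegral.integral_congr fun u hu => ?_
    rw [Set.uIcc_of_le (sub_nonneg.2 t.2.2)] at hu
    simp only [abs_of_nonneg hu.1]

theorem integral_one_add_div_rpow {e β : ℝ} (he : 0 < e) (hβ : β ≠ 1) {r : ℝ} (hr : 0 ≤ r) :
    ∫ u in (0 : ℝ)..r, (1 + u / e) ^ (-β) = e / (1 - β) * ((1 + r / e) ^ (1 - β) - 1) := by
  have h1 : 1 - β ≠ 0 := sub_ne_zero.2 hβ.symm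
  have hpos : ∀ u ∈ Set.uIcc 0 r, 0 < 1 + u / e := fun u hu => by
    rw [Set.uIcc_of_le hr] at hu
    have := hu.1
    positivity
  rw [intervalIntegral.integral_eq_sub_of_hasDerivAt
    (f := fun u => e / (1 - β) * (1 + u / e) ^ (1 - β))]
  · simp
    ring
  · intro u hu
    have := (((hasDerivAt_id u).div_const e).const_add 1).rpow_const (p := 1 - β)
      (Or.inl (hpos u hu).ne')
    convert! this.const_mul (e / (1 - β)) using 1
    rw [show 1 - β - 1 = -β by ring]
    simp
    field_simp
  · refine ContinuousOn.intervalIntegrable ?_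
    exact ContinuousOn.rpow_const (by fun_prop) fun u hu => Or.inl (hpos u hu).ne'

theorem integral_decayKernel_eq {e : ℝ} (he : 0 < e) (β : ℝ) (t : unitInterval) :
    ∫ s, decayKernel e β t s =
      (∫ u in (0 : ℝ)..t, (1 + u / e) ^ (-β)) + ∫ u in (0 : ℝ)..(1 - t), (1 + u / e) ^ (-β) := by
  refine integral_unitInterval_abs_sub (φ := fun u => (1 + u / e) ^ (-β)) ?_ t
  refine Continuous.rpow_const (by fun_prop) fun q => Or.inl ?_
  positivity

/-- Subadditivity of `x ↦ x^(1-β)` cancels the `-1` in the primitive and leaves `e · e^(-(1-β)) =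
e^β`; the two sides of `t` account for the factor 2. -/
theorem integral_decayKernel_le {e β : ℝ} (he : 0 < e) (hβ0 : 0 ≤ β) (hβ : β < 1)
    (t : unitInterval) : ∫ s, decayKernel e β t s ≤ 2 / (1 - β) * e ^ β := by
  have key : ∀ r : ℝ, 0 ≤ r → r ≤ 1 →
      ∫ u in (0 : ℝ)..r, (1 + u / e) ^ (-β) ≤ 1 / (1 - β) * e ^ β := by
    intro r h0 h1
    rw [integral_one_add_div_rpow he hβ.ne h0]
    have h2 : 0 < 1 - β := by linarith
    have h3 : (1 + r / e) ^ (1 - β) ≤ 1 + (r / e) ^ (1 - β) := by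
      simpa using Real.rpow_add_le_add_rpow (by positivity : (0 : ℝ) ≤ 1)
        (by positivity : 0 ≤ r / e) h2.le (by linarith)
    have h4 : (r / e) ^ (1 - β) ≤ e ^ (-(1 - β)) := by
      rw [Real.rpow_neg he.le, ← Real.inv_rpow he.le, ← one_div]
      gcongr
    have h5 : e ^ β = e * e ^ (-(1 - β)) := by
      nth_rewrite 2 [← Real.rpow_one e]
      rw [← Real.rpow_add he]
      congr 1
      ring
    rw [h5, div_mul_eq_mul_div, div_mul_eq_mul_div, one_mul]
    gcongr
    linarith
  rw [integral_decayKernel_eq he]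
  have k1 := key t t.2.1 t.2.2
  have k2 := key (1 - t) (sub_nonneg.2 t.2.2) (by linarith [t.2.1])
  calc _ ≤ _ := add_le_add k1 k2
    _ = _ := by ring

/-- The kernels form a path on four vertices: integrating the two end vertices gives `K` each, and
the middle edge a third `K`. -/
theorem integral_decayKernel_tree_le {e β K : ℝ} (he : 0 < e)
    (hK : ∀ t, ∫ s, decayKernel e β t s ≤ K) :
    ∫ r : (unitInterval × unitInterval) × (unitInterval × unitInterval),
      decayKernel e β r.1.1 r.1.2 * (decayKernel e β r.1.2 r.2.2 * decayKernel e β r.1.1 r.2.1)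
      ≤ K ^ 3 := by
  have hk := continuous_decayKernel he β
  have hk0 : ∀ s t, 0 < decayKernel e β s t := decayKernel_pos he β
  have hI0 : ∀ t, 0 ≤ ∫ s, decayKernel e β t s := fun t => integral_nonneg fun s => (hk0 t s).le
  have hK0 : 0 ≤ K := (hI0 0).trans (hK 0)
  have hcont : Continuous fun r : (unitInterval × unitInterval) × (unitInterval × unitInterval) =>
      decayKernel e β r.1.1 r.1.2 *
        (decayKernel e β r.1.2 r.2.2 * decayKernel e β r.1.1 r.2.1) := by
    refine (hk.comp (by fun_prop : Continuous fun r : (unitInterval × unitInterval) ×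
      (unitInterval × unitInterval) => (r.1.1, r.1.2))).mul
      ((hk.comp (by fun_prop : Continuous fun r : (unitInterval × unitInterval) ×
      (unitInterval × unitInterval) => (r.1.2, r.2.2))).mul
      (hk.comp (by fun_prop : Continuous fun r : (unitInterval × unitInterval) ×
      (unitInterval × unitInterval) => (r.1.1, r.2.1))))
  have hint := integrable_of_continuous_of_compactSpace (μ := volume) hcont
  rw [Measure.volume_eq_prod, integral_prod _ hint]
  have hinner : ∀ q : unitInterval × unitInterval,
      ∫ q' : unitInterval × unitInterval, decayKernel e β q.1 q.2 *
        (decayKernel e β q.2 q'.2 * decayKernel e β q.1 q'.1) ≤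
        decayKernel e β q.1 q.2 * K ^ 2 := by
    intro q
    rw [integral_const_mul]
    refine mul_le_mul_of_nonneg_left ?_ (hk0 _ _).le
    simp_rw [mul_comm (decayKernel e β q.2 _)]
    rw [Measure.volume_eq_prod, integral_prod_mul, sq]
    exact mul_le_mul (hK _) (hK _) (hI0 _) hK0
  have hkint : Integrable fun q : unitInterval × unitInterval => decayKernel e β q.1 q.2 :=
    integrable_of_continuous_of_compactSpace hk
  calc _ ≤ ∫ q : unitInterval × unitInterval, decayKernel e β q.1 q.2 * K ^ 2 :=
        integral_mono hint.integral_prod_left (hkint.mul_const _) hinner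
    _ = (∫ t, ∫ s, decayKernel e β t s) * K ^ 2 := by
        rw [integral_mul_const, Measure.volume_eq_prod, integral_prod _ hkint]
    _ ≤ K * K ^ 2 := by
        gcongr
        simpa using integral_mono (μ := (volume : Measure unitInterval)) hkint.integral_prod_left
          (integrable_const K) hK
    _ = K ^ 3 := by ring

/-! ### Variance of the self-intersections -/

section Variance

variable {Ω : Type*} [MeasurableSpace Ω] {P : Measure Ω} {d : ℕ}
  {B : unitInterval → Ω → EuclideanSpace ℝ (Fin d)}

theorem gaussKernel_pos (σ : ℝ) (y : EuclideanSpace ℝ (Fin d)) : 0 < gaussKernel σ y :=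
  Real.exp_pos _

theorem gaussKernel_le_one (σ : ℝ) (y : EuclideanSpace ℝ (Fin d)) : gaussKernel σ y ≤ 1 := by
  rw [gaussKernel, Real.exp_le_one_iff]
  exact div_nonpos_of_nonpos_of_nonneg (by simp) (by positivity)

theorem continuous_gaussKernel (σ : ℝ) :
    Continuous (gaussKernel σ : EuclideanSpace ℝ (Fin d) → ℝ) := by
  unfold gaussKernel; fun_prop

theorem measurable_gaussKernel_sub (hBm : Measurable (Function.uncurry B)) (σ : ℝ) :
    Measurable (Function.uncurry fun (q : unitInterval × unitInterval) ω =>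
      gaussKernel σ (B q.1 ω - B q.2 ω)) := by
  have h1 : Measurable fun x : (unitInterval × unitInterval) × Ω =>
      Function.uncurry B (x.1.1, x.2) := by fun_prop
  have h2 : Measurable fun x : (unitInterval × unitInterval) × Ω =>
      Function.uncurry B (x.1.2, x.2) := by fun_prop
  have hg : Measurable (gaussKernel σ : EuclideanSpace ℝ (Fin d) → ℝ) :=
    (continuous_gaussKernel σ).measurable
  simp only [Function.uncurry_def] at h1 h2 ⊢
  fun_prop

theorem approxSelfIntersections_eq_integral_prod (hBm : Measurable (Function.uncurry B)) (σ : ℝ)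
    (ω : Ω) : approxSelfIntersections B σ ω =
      ∫ q : unitInterval × unitInterval, gaussKernel σ (B q.1 ω - B q.2 ω) := by
  rw [approxSelfIntersections, Measure.volume_eq_prod, integral_prod]
  refine Integrable.of_bound (Measurable.aestronglyMeasurable ?_) 1 (Eventually.of_forall fun q => ?_)
  · exact (measurable_gaussKernel_sub hBm σ).of_uncurry_right
  · rw [Real.norm_of_nonneg (gaussKernel_pos _ _).le]
    exact gaussKernel_le_one _ _

/-- The mean of `approxSelfIntersections B σ`, with `e = σ ^ 2` and `p = d / 2`. -/
noncomputable def meanSelfIntersections (e p : ℝ) : ℝ :=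
  ∫ q : unitInterval × unitInterval, decayKernel e p q.1 q.2

theorem IsStandardBrownianMotion.integral_sq_approxSelfIntersections_sub_le
    [IsProbabilityMeasure P]
    (hB : IsStandardBrownianMotion B P) (hBm : Measurable (Function.uncurry B)) (hd : 2 ≤ d)
    {σ β : ℝ} (hσ : 0 < σ) (hβ0 : 0 ≤ β) (hβ1 : β < 1) (hβ : β ≤ ((d : ℝ) / 2 + 1) / 3) :
    ∫ ω, (approxSelfIntersections B σ ω - meanSelfIntersections (σ ^ 2) (d / 2)) ^ 2 ∂P ≤
      d * (2 / (1 - β) * (σ ^ 2) ^ β) ^ 3 := by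
  have hσ2 : 0 < σ ^ 2 := by positivity
  simp_rw [approxSelfIntersections_eq_integral_prod hBm]
  have hmean : meanSelfIntersections (σ ^ 2) (d / 2) = ∫ q : unitInterval × unitInterval,
      ∫ ω, gaussKernel σ (B q.1 ω - B q.2 ω) ∂P := by
    unfold meanSelfIntersections
    simp_rw [hB.integral_gaussKernel_eq_decayKernel hσ]
  rw [hmean, integral_sq_integral_sub_eq (measurable_gaussKernel_sub hBm σ) (C := 1)
    (fun q ω => by rw [abs_of_pos (gaussKernel_pos _ _)]; exact gaussKernel_le_one _ _)]
  simp_rw [hB.integral_gaussKernel_eq_decayKernel hσ]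
  set e := σ ^ 2 with he
  have hk := continuous_decayKernel hσ2 β
  have hK := integral_decayKernel_le hσ2 hβ0 hβ1
  have hcov := fun r : (unitInterval × unitInterval) × (unitInterval × unitInterval) =>
    hB.covariance_gaussKernel_le hd hσ hβ r.1.2 r.1.1 r.2.2 r.2.1
  set G1 : (unitInterval × unitInterval) × (unitInterval × unitInterval) → ℝ := fun r =>
    decayKernel e β r.1.1 r.1.2 * (decayKernel e β r.1.2 r.2.2 * decayKernel e β r.1.1 r.2.1)
    with hG1
  set G2 : (unitInterval × unitInterval) × (unitInterval × unitInterval) → ℝ := fun r =>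
    decayKernel e β r.1.1 r.1.2 * (decayKernel e β r.1.2 r.2.1 * decayKernel e β r.1.1 r.2.2)
    with hG2
  have hG1c : Continuous G1 := by
    refine (hk.comp (by fun_prop : Continuous fun r : (unitInterval × unitInterval) ×
      (unitInterval × unitInterval) => (r.1.1, r.1.2))).mul
      ((hk.comp (by fun_prop : Continuous fun r : (unitInterval × unitInterval) ×
      (unitInterval × unitInterval) => (r.1.2, r.2.2))).mul
      (hk.comp (by fun_prop : Continuous fun r : (unitInterval × unitInterval) ×
      (unitInterval × unitInterval) => (r.1.1, r.2.1))))
  have hswap : MeasurePreserving (Prod.map id Prod.swap :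
      (unitInterval × unitInterval) × (unitInterval × unitInterval) → _) volume volume :=
    (MeasurePreserving.id volume).prod (Measure.measurePreserving_swap)
  have hG21 : G2 = G1 ∘ Prod.map id Prod.swap := rfl
  have hG1i : Integrable G1 := integrable_of_continuous_of_compactSpace hG1c
  have hG2i : Integrable G2 := by
    rw [hG21]
    exact integrable_of_continuous_of_compactSpace (hG1c.comp (by fun_prop))
  have hI1 : ∫ r, G1 r ≤ (2 / (1 - β) * e ^ β) ^ 3 := integral_decayKernel_tree_le hσ2 hK
  have hI2 : ∫ r, G2 r = ∫ r, G1 r := by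
    rw [hG21]
    exact hswap.integral_comp (MeasurableEquiv.prodCongr (MeasurableEquiv.refl _)
      MeasurableEquiv.prodComm).measurableEmbedding G1
  calc _ ≤ ∫ r, (d / 2 : ℝ) * (G1 r + G2 r) := by
        by_cases hint : Integrable (fun r : (unitInterval × unitInterval) ×
          (unitInterval × unitInterval) =>
          ∫ ω, gaussKernel σ (B r.1.1 ω - B r.1.2 ω) * gaussKernel σ (B r.2.1 ω - B r.2.2 ω) ∂P -
          decayKernel e (d / 2) r.1.1 r.1.2 * decayKernel e (d / 2) r.2.1 r.2.2)
        · exact integral_mono hint ((hG1i.add hG2i).const_mul _) hcov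
        -- A non-integrable function has integral 0 by convention, and the upper bound is
        -- nonnegative, so integrability of the covariance is not needed.
        · rw [← Measure.volume_eq_prod, integral_undef hint]
          refine integral_nonneg fun r => ?_
          have := fun a b => (decayKernel_pos hσ2 β a b).le
          have h1 : 0 ≤ G1 r := mul_nonneg (this _ _) (mul_nonneg (this _ _) (this _ _))
          have h2 : 0 ≤ G2 r := mul_nonneg (this _ _) (mul_nonneg (this _ _) (this _ _))
          positivity
    _ = d * ∫ r, G1 r := by
        rw [integral_const_mul, integral_add hG1i hG2i, hI2]
        ring
    _ ≤ _ := by gcongr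

end Variance

/-! ### Asymptotics of the mean -/

theorem meanSelfIntersections_eq {e p : ℝ} (he : 0 < e) {G : ℝ → ℝ}
    (hG : ContinuousOn G (Set.Icc 0 1))
    (h : ∀ r ∈ Set.Icc (0 : ℝ) 1, ∫ u in (0 : ℝ)..r, (1 + u / e) ^ (-p) = G r) :
    meanSelfIntersections e p = 2 * ∫ t in (0 : ℝ)..1, G t := by
  have hkint : Integrable fun q : unitInterval × unitInterval => decayKernel e p q.1 q.2 :=
    integrable_of_continuous_of_compactSpace (continuous_decayKernel he p)
  have h1 : ∀ t : unitInterval, ∫ s, decayKernel e p t s = G t + G (1 - t) := fun t => by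
    rw [integral_decayKernel_eq he, h t t.2, h (1 - t) ⟨sub_nonneg.2 t.2.2, by linarith [t.2.1]⟩]
  rw [meanSelfIntersections, Measure.volume_eq_prod, integral_prod _ hkint]
  simp_rw [h1]
  rw [integral_unitInterval_eq (fun t => G t + G (1 - t)), intervalIntegral.integral_add,
    intervalIntegral.integral_comp_sub_left]
  · simp only [sub_self, sub_zero]
    ring
  · exact ContinuousOn.intervalIntegrable (by rwa [Set.uIcc_of_le zero_le_one])
  · refine ContinuousOn.intervalIntegrable ?_
    rw [Set.uIcc_of_le zero_le_one]
    exact hG.comp (by fun_prop) fun x hx => ⟨sub_nonneg.2 hx.2, by linarith [hx.1]⟩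

/-- The primitive gives the mean in closed form up to `∫ (1 + t/e)^(-(p-1))`, which vanishes in the
limit by dominated convergence. -/
theorem tendsto_meanSelfIntersections_div {p : ℝ} (hp : 1 < p) :
    Tendsto (fun e => meanSelfIntersections e p / e) (𝓝[>] 0) (𝓝 (2 / (p - 1))) := by
  have hp' : 0 < p - 1 := sub_pos.2 hp
  have hcont : ∀ e : ℝ, 0 < e →
      ContinuousOn (fun t : ℝ => (1 + t / e) ^ (-(p - 1))) (Set.Icc 0 1) := fun e he => by
    refine ContinuousOn.rpow_const (by fun_prop) fun t ht => Or.inl ?_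
    have := ht.1
    positivity
  have hev : ∀ e : ℝ, 0 < e → meanSelfIntersections e p / e =
      2 / (p - 1) * (1 - ∫ t in (0 : ℝ)..1, (1 + t / e) ^ (-(p - 1))) := by
    intro e he
    rw [meanSelfIntersections_eq he
      (G := fun t => e / (p - 1) * (1 - (1 + t / e) ^ (-(p - 1))))
      ((continuousOn_const.sub (hcont e he)).const_mul _)]
    · rw [intervalIntegral.integral_const_mul, intervalIntegral.integral_sub (by simp)]
      · simp
        field_simp
      · exact ContinuousOn.intervalIntegrable (by rw [Set.uIcc_of_le zero_le_one]; exact hcont e he)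
    · intro r hr
      rw [integral_one_add_div_rpow he hp.ne' hr.1]
      rw [show 1 - p = -(p - 1) by ring, div_neg]
      ring
  have hlim : Tendsto (fun e : ℝ => ∫ t in (0 : ℝ)..1, (1 + t / e) ^ (-(p - 1))) (𝓝[>] 0)
      (𝓝 (∫ t in (0 : ℝ)..1, (0 : ℝ))) := by
    refine intervalIntegral.tendsto_integral_filter_of_dominated_convergence (fun _ => 1)
      ?_ ?_ (by simp) ?_
    · filter_upwards [self_mem_nhdsWithin] with e he
      refine ((hcont e he).mono ?_).aestronglyMeasurable measurableSet_uIoc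
      rw [Set.uIoc_of_le zero_le_one]
      exact Set.Ioc_subset_Icc_self
    · filter_upwards [self_mem_nhdsWithin] with e he
      have he' : 0 < e := he
      refine Eventually.of_forall fun t ht => ?_
      rw [Set.uIoc_of_le zero_le_one] at ht
      have h1 : 0 ≤ t / e := div_nonneg ht.1.le he'.le
      rw [Real.norm_of_nonneg (by positivity)]
      exact Real.rpow_le_one_of_one_le_of_nonpos (by linarith) (by linarith)
    · refine Eventually.of_forall fun t ht => ?_
      rw [Set.uIoc_of_le zero_le_one] at ht
      have h1 : Tendsto (fun e : ℝ => t / e) (𝓝[>] 0) atTop := by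
        simpa only [div_eq_mul_inv] using tendsto_inv_nhdsGT_zero.const_mul_atTop ht.1
      exact (tendsto_rpow_neg_atTop hp').comp (tendsto_atTop_add_const_left _ _ h1)
  have := (hlim.const_sub 1).const_mul (2 / (p - 1))
  simp only [intervalIntegral.integral_zero, sub_zero, mul_one] at this
  refine this.congr' ?_
  filter_upwards [self_mem_nhdsWithin] with e he
  rw [hev e he]

theorem meanSelfIntersections_one {e : ℝ} (he : 0 < e) :
    meanSelfIntersections e 1 = 2 * e * ((e + 1) * Real.log (1 + 1 / e) - 1) := by
  have hpos : ∀ u : ℝ, 0 ≤ u → 0 < 1 + u / e := fun u hu => by positivity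
  have hderiv : ∀ u : ℝ, 0 ≤ u →
      HasDerivAt (fun u => Real.log (1 + u / e)) ((1 / e) / (1 + u / e)) u :=
    fun u hu => (((hasDerivAt_id u).div_const e).const_add 1).log (hpos u hu).ne'
  have hcont : ContinuousOn (fun t : ℝ => Real.log (1 + t / e)) (Set.Icc 0 1) :=
    fun u hu => (hderiv u hu.1).continuousAt.continuousWithinAt
  rw [meanSelfIntersections_eq he (G := fun t => e * Real.log (1 + t / e)) (hcont.const_mul _)]
  · rw [intervalIntegral.integral_const_mul, intervalIntegral.integral_eq_sub_of_hasDerivAt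
      (f := fun t => (e + t) * Real.log (1 + t / e) - t)]
    · simp
      ring
    · intro u hu
      rw [Set.uIcc_of_le zero_le_one] at hu
      have h1 := (((hasDerivAt_id u).const_add e).mul (hderiv u hu.1)).sub (hasDerivAt_id u)
      convert! h1 using 1
      have := (hpos u hu.1).ne'
      simp only [id]
      have h2 : (e + u) * ((1 / e) / (1 + u / e)) = 1 := by
        have : e + u ≠ 0 := by have := hu.1; positivity
        field_simp
      rw [h2]; ring
    · exact ContinuousOn.intervalIntegrable (by rwa [Set.uIcc_of_le zero_le_one])
  · intro r hr
    rw [intervalIntegral.integral_eq_sub_of_hasDerivAt (f := fun t => e * Real.log (1 + t / e))]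
    · simp
    · intro u hu
      rw [Set.uIcc_of_le hr.1] at hu
      convert! (hderiv u hu.1).const_mul e using 1
      rw [Real.rpow_neg_one]
      field_simp
    · refine ContinuousOn.intervalIntegrable (ContinuousOn.rpow_const (by fun_prop) fun u hu => ?_)
      rw [Set.uIcc_of_le hr.1] at hu
      exact Or.inl (hpos u hu.1).ne'

theorem tendsto_meanSelfIntersections_one_div :
    Tendsto (fun σ : ℝ => meanSelfIntersections (σ ^ 2) 1 / (σ ^ 2 * Real.log (1 / σ)))
      (𝓝[>] 0) (𝓝 4) := by
  have hlog : Tendsto (fun σ : ℝ => (Real.log (1 / σ))⁻¹) (𝓝[>] 0) (𝓝 0) := by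
    have h1 : Tendsto (fun σ : ℝ => 1 / σ) (𝓝[>] 0) atTop := by
      simpa only [one_div] using tendsto_inv_nhdsGT_zero
    exact tendsto_inv_atTop_zero.comp (Real.tendsto_log_atTop.comp h1)
  have hcont : Tendsto (fun σ : ℝ => (σ ^ 2 + 1) * Real.log (1 + σ ^ 2)) (𝓝[>] 0) (𝓝 0) := by
    have : ContinuousAt (fun σ : ℝ => (σ ^ 2 + 1) * Real.log (1 + σ ^ 2)) 0 := by
      refine ContinuousAt.mul (by fun_prop) (ContinuousAt.log (by fun_prop) (by norm_num))
    simpa using this.tendsto.mono_left nhdsWithin_le_nhds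
  have hsq : Tendsto (fun σ : ℝ => σ ^ 2 + 1) (𝓝[>] 0) (𝓝 1) := by
    have : ContinuousAt (fun σ : ℝ => σ ^ 2 + 1) 0 := by fun_prop
    simpa using this.tendsto.mono_left nhdsWithin_le_nhds
  have h := (hsq.const_mul 4).add (((hcont.sub_const 1).mul hlog).const_mul 2)
  simp only [mul_one, mul_zero, add_zero] at h
  refine h.congr' ?_
  filter_upwards [Ioo_mem_nhdsGT (zero_lt_one (α := ℝ))] with σ hσ
  have hσ0 : 0 < σ := hσ.1
  have hL : 0 < Real.log (1 / σ) := Real.log_pos (by rw [lt_div_iff₀ hσ0]; linarith [hσ.2])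
  rw [meanSelfIntersections_one (by positivity)]
  -- The factor 2 from `log(1/σ²)` doubles the 2 in the mean and yields the limit 4.
  have : Real.log (1 + 1 / σ ^ 2) = Real.log (1 + σ ^ 2) + 2 * Real.log (1 / σ) := by
    rw [show (1 + 1 / σ ^ 2) = (1 + σ ^ 2) * (1 / σ) ^ 2 by field_simp; ring,
      Real.log_mul (by positivity) (by positivity), Real.log_pow]
    norm_num
  rw [this]
  field_simp
  ring

/-! ### Almost sure convergence along scales and interpolation -/

/-- The variables `B t` are only almost everywhere measurable, while Fubini needs joint
measurability. Setting the process to 0 off a measurable full set, where paths are continuous and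
agree with measurable versions at a dense sequence of times, makes every `B' t` measurable;
continuity in `t` then gives joint measurability. -/
theorem IsStandardBrownianMotion.exists_measurable_version {Ω : Type*} [MeasurableSpace Ω]
    {P : Measure Ω} {d : ℕ} {B : unitInterval → Ω → EuclideanSpace ℝ (Fin d)}
    (hB : IsStandardBrownianMotion B P) :
    ∃ B' : unitInterval → Ω → EuclideanSpace ℝ (Fin d), IsStandardBrownianMotion B' P ∧
      Measurable (Function.uncurry B') ∧ ∀ᵐ ω ∂P, ∀ t, B' t ω = B t ω := by
  have hae : ∀ t, AEMeasurable (B t) P := fun t => by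
    refine (hB.law_increment 0 t unitInterval.nonneg').aemeasurable.congr ?_
    filter_upwards [hB.start_zero] with ω hω
    rw [hω, sub_zero]
  have hgood : ∀ᵐ ω ∂P, Continuous (fun t => B t ω) ∧
      ∀ n, B (TopologicalSpace.denseSeq unitInterval n) ω = (hae _).mk _ ω :=
    hB.continuous_paths.and (ae_all_iff.2 fun n => (hae _).ae_eq_mk)
  obtain ⟨G, hGae, hGm, hG⟩ := hgood.exists_measurable_mem
  have hver : ∀ᵐ ω ∂P, ∀ t, G.indicator (B t) ω = B t ω := by
    filter_upwards [hGae] with ω hω t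
    exact Set.indicator_of_mem hω _
  have hcont : ∀ ω, Continuous fun t => G.indicator (B t) ω := fun ω => by
    by_cases hω : ω ∈ G
    · simp only [Set.indicator_of_mem hω]
      exact (hG ω hω).1
    · simp only [Set.indicator_of_notMem hω]
      exact continuous_const
  have hdense : ∀ n, Measurable (G.indicator (B (TopologicalSpace.denseSeq unitInterval n))) :=
    fun n => by
      rw [Set.indicator_congr fun ω hω => (hG ω hω).2 n]
      exact (hae _).measurable_mk.indicator hGm
  have hmeas : ∀ t, Measurable (G.indicator (B t)) := fun t => by
    obtain ⟨x, hx, hxt⟩ := mem_closure_iff_seq_limit.1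
      ((TopologicalSpace.denseRange_denseSeq unitInterval).closure_eq ▸ Set.mem_univ t)
    refine measurable_of_tendsto_metrizable (f := fun n => G.indicator (B (x n))) (fun n => ?_)
      (tendsto_pi_nhds.2 fun ω => ((hcont ω).tendsto t).comp hxt)
    obtain ⟨m, hm⟩ := hx n
    rw [← hm]
    exact hdense m
  refine ⟨fun t => G.indicator (B t), ⟨?_, ?_, ?_, ?_⟩,
    measurable_uncurry_of_continuous_of_measurable hcont hmeas, hver⟩
  · filter_upwards [hver, hB.start_zero] with ω h h0
    rw [h, h0]
  · intro n t ht
    refine (hB.indep_increments n t ht).congr fun i => ?_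
    filter_upwards [hver] with ω h
    rw [h, h]
  · intro s t hst
    refine (hB.law_increment s t hst).congr ?_
    filter_upwards [hver] with ω h
    rw [h, h]
  · exact Eventually.of_forall hcont

/-- The sum of the `X n ^ 2` has finite integral, so it is almost surely finite and its terms tend
to 0. -/
theorem ae_tendsto_zero_of_summable_integral_sq {Ω : Type*} [MeasurableSpace Ω] {P : Measure Ω}
    {X : ℕ → Ω → ℝ} (hX : ∀ n, MemLp (X n) 2 P) {b : ℕ → ℝ} (hb : Summable b)
    (h : ∀ n, ∫ ω, X n ω ^ 2 ∂P ≤ b n) :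
    ∀ᵐ ω ∂P, Tendsto (fun n => X n ω) atTop (𝓝 0) := by
  have hsum : Summable fun n => ∫ ω, X n ω ^ 2 ∂P :=
    hb.of_nonneg_of_le (fun n => integral_nonneg fun ω => sq_nonneg _) h
  have hm : ∀ n, AEMeasurable (fun ω => ENNReal.ofReal (X n ω ^ 2)) P := fun n =>
    ((hX n).aestronglyMeasurable.aemeasurable.pow_const 2).ennreal_ofReal
  have hlt : ∫⁻ ω, ∑' n, ENNReal.ofReal (X n ω ^ 2) ∂P ≠ ⊤ := by
    rw [lintegral_tsum hm]
    simp_rw [fun n => (ofReal_integral_eq_lintegral_ofReal (hX n).integrable_sq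
      (Eventually.of_forall fun ω => sq_nonneg (X n ω))).symm]
    exact hsum.tsum_ofReal_ne_top
  filter_upwards [ae_lt_top' (AEMeasurable.tsum hm) hlt] with ω hω
  have h1 := ENNReal.tendsto_atTop_zero_of_tsum_ne_top hω.ne
  have h2 := (ENNReal.tendsto_toReal ENNReal.zero_ne_top).comp h1
  have h3 : Tendsto (fun n => X n ω ^ 2) atTop (𝓝 0) := by
    refine Tendsto.congr (fun n => ?_) h2
    simp only [Function.comp_apply]
    exact ENNReal.toReal_ofReal (sq_nonneg _)
  have h4 := h3.sqrt
  simp_rw [Real.sqrt_sq_eq_abs, Real.sqrt_zero] at h4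
  exact tendsto_zero_iff_abs_tendsto_zero _ |>.2 h4

/-- The scales `exp (-n ^ (2 / 3))`, along which almost sure convergence is first established. -/
noncomputable def scaleSeq (n : ℕ) : ℝ := Real.exp (-(n : ℝ) ^ (2 / 3 : ℝ))

theorem scaleSeq_pos (n : ℕ) : 0 < scaleSeq n := Real.exp_pos _

theorem log_one_div_scaleSeq (n : ℕ) : Real.log (1 / scaleSeq n) = (n : ℝ) ^ (2 / 3 : ℝ) := by
  rw [one_div, Real.log_inv, scaleSeq, Real.log_exp, neg_neg]

theorem scaleSeq_lt_one {n : ℕ} (hn : 1 ≤ n) : scaleSeq n < 1 := by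
  have : (0 : ℝ) < n := by exact_mod_cast hn
  rw [scaleSeq, Real.exp_lt_one_iff, neg_lt_zero]
  positivity

theorem tendsto_scaleSeq : Tendsto scaleSeq atTop (𝓝[>] 0) := by
  refine tendsto_nhdsWithin_iff.2 ⟨?_, Eventually.of_forall scaleSeq_pos⟩
  refine Real.tendsto_exp_neg_atTop_nhds_zero.comp ?_
  exact (tendsto_rpow_atTop (by norm_num)).comp tendsto_natCast_atTop_atTop

/-- The exponent `2/3` is below 1, so the gaps of `n^(2/3)` vanish; it is above `1/2`, so the
variances `n^(-4/3)` are summable. -/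
theorem tendsto_scaleSeq_div_succ :
    Tendsto (fun n => scaleSeq n / scaleSeq (n + 1)) atTop (𝓝 1) := by
  have h1 : Tendsto (fun n : ℕ => ((n + 1 : ℕ) : ℝ) ^ (2 / 3 : ℝ) - (n : ℝ) ^ (2 / 3 : ℝ)) atTop
      (𝓝 0) := by
    have hlim : Tendsto (fun n : ℕ => (2 / 3 : ℝ) * (n : ℝ) ^ (-(1 / 3 : ℝ))) atTop (𝓝 0) := by
      have := ((tendsto_rpow_neg_atTop (y := 1 / 3) (by norm_num)).comp
        tendsto_natCast_atTop_atTop).const_mul (2 / 3 : ℝ)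
      simpa using this
    refine squeeze_zero' (Eventually.of_forall fun n => ?_) ?_ hlim
    · refine sub_nonneg.2 (Real.rpow_le_rpow (by positivity) ?_ (by norm_num))
      push_cast; linarith
    · filter_upwards [eventually_ge_atTop 1] with n hn
      have hn0 : (0 : ℝ) < n := by exact_mod_cast hn
      have h2 := rpow_one_add_le_one_add_mul_self (s := 1 / (n : ℝ)) (p := 2 / 3)
        (by have : 0 ≤ 1 / (n : ℝ) := by positivity
            linarith) (by norm_num) (by norm_num)
      have h3 : ((n + 1 : ℕ) : ℝ) ^ (2 / 3 : ℝ) =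
          (n : ℝ) ^ (2 / 3 : ℝ) * (1 + 1 / n) ^ (2 / 3 : ℝ) := by
        rw [← Real.mul_rpow hn0.le (by positivity)]
        congr 1
        push_cast
        field_simp
      have h4 : (n : ℝ) ^ (-(1 / 3 : ℝ)) = (n : ℝ) ^ (2 / 3 : ℝ) * (1 / n) := by
        rw [one_div (n : ℝ), ← Real.rpow_neg_one (n : ℝ), ← Real.rpow_add hn0]
        norm_num
      rw [h3, h4]
      have h5 : 0 ≤ (n : ℝ) ^ (2 / 3 : ℝ) := by positivity
      nlinarith
  have h2 := (Real.continuous_exp.tendsto 0).comp h1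
  rw [Real.exp_zero] at h2
  refine h2.congr fun n => ?_
  simp only [Function.comp_apply, scaleSeq]
  rw [← Real.exp_sub]
  congr 1
  ring

theorem exists_scaleSeq_lt_le :
    ∃ N : ℝ → ℕ, Tendsto N (𝓝[>] 0) atTop ∧
      ∀ σ : ℝ, 0 < σ → σ < 1 → scaleSeq (N σ + 1) < σ ∧ σ ≤ scaleSeq (N σ) := by
  refine ⟨fun σ => ⌊Real.log (1 / σ) ^ (3 / 2 : ℝ)⌋₊, ?_, fun σ h0 h1 => ?_⟩
  · have h1 : Tendsto (fun σ : ℝ => 1 / σ) (𝓝[>] 0) atTop := by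
      simpa only [one_div] using tendsto_inv_nhdsGT_zero
    exact tendsto_nat_floor_atTop.comp ((tendsto_rpow_atTop (by norm_num)).comp
      (Real.tendsto_log_atTop.comp h1))
  · have hL : 0 < Real.log (1 / σ) := Real.log_pos (by rwa [lt_div_iff₀ h0, one_mul])
    have hLL : (Real.log (1 / σ) ^ (3 / 2 : ℝ)) ^ (2 / 3 : ℝ) = Real.log (1 / σ) := by
      rw [← Real.rpow_mul hL.le]; norm_num
    have hσ : σ = Real.exp (-Real.log (1 / σ)) := by
      rw [one_div, Real.log_inv, neg_neg, Real.exp_log h0]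
    constructor
    · conv_rhs => rw [hσ]
      rw [scaleSeq, Real.exp_lt_exp, neg_lt_neg_iff]
      conv_lhs => rw [← hLL]
      refine Real.rpow_lt_rpow (by positivity) ?_ (by norm_num)
      push_cast
      exact Nat.lt_floor_add_one _
    · conv_lhs => rw [hσ]
      rw [scaleSeq, Real.exp_le_exp, neg_le_neg_iff]
      conv_rhs => rw [← hLL]
      exact Real.rpow_le_rpow (by positivity) (Nat.floor_le (by positivity)) (by norm_num)

/-- For `σ_(n+1) < σ ≤ σ_n`, monotonicity of `S` and `l` puts the quotient between its values at
`σ_(n+1)` and `σ_n`, up to the factor `(σ_n/σ_(n+1))²`, which tends to 1. -/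
theorem tendsto_div_sq_mul_of_tendsto_scaleSeq {S l : ℝ → ℝ} {L : ℝ}
    (hS : MonotoneOn S (Set.Ioi 0)) (hS0 : ∀ σ, 0 ≤ S σ) (hl : AntitoneOn l (Set.Ioo 0 1))
    (hl0 : ∀ σ ∈ Set.Ioo (0 : ℝ) 1, 0 < l σ)
    (h : Tendsto (fun n => S (scaleSeq n) / (scaleSeq n ^ 2 * l (scaleSeq n))) atTop (𝓝 L)) :
    Tendsto (fun σ => S σ / (σ ^ 2 * l σ)) (𝓝[>] 0) (𝓝 L) := by
  obtain ⟨N, hN, hNσ⟩ := exists_scaleSeq_lt_le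
  have hup := ((h.mul (tendsto_scaleSeq_div_succ.pow 2)).comp hN)
  have hlow := (((h.comp (tendsto_add_atTop_nat 1)).div (tendsto_scaleSeq_div_succ.pow 2)
    (by norm_num)).comp hN)
  simp only [one_pow, mul_one, div_one] at hup hlow
  -- Since `scaleSeq 0 = 1`, the index must be at least 1 for `scaleSeq (N σ)` to lie in `(0, 1)`,
  -- where `l` is controlled.
  have hbound : ∀ᶠ σ : ℝ in 𝓝[>] 0, 0 < σ ∧ σ < 1 ∧ 1 ≤ N σ := by
    filter_upwards [Ioo_mem_nhdsGT (zero_lt_one (α := ℝ)), hN.eventually_ge_atTop 1] with σ h1 h2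
    exact ⟨h1.1, h1.2, h2⟩
  refine tendsto_of_tendsto_of_tendsto_of_le_of_le' hlow hup ?_ ?_
  · filter_upwards [hbound] with σ ⟨h0, h1, hN1⟩
    obtain ⟨hlt, hle⟩ := hNσ σ h0 h1
    have p0 := scaleSeq_pos (N σ)
    have p1 := scaleSeq_pos (N σ + 1)
    have l1 := scaleSeq_lt_one (n := N σ + 1) (by omega)
    have q0 := hl0 σ ⟨h0, h1⟩
    have q1 := hl0 _ ⟨p1, l1⟩
    simp only [Function.comp_apply, Pi.div_apply]
    calc _ = S (scaleSeq (N σ + 1)) / (scaleSeq (N σ) ^ 2 * l (scaleSeq (N σ + 1))) := by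
          field_simp
      _ ≤ S σ / (σ ^ 2 * l σ) := by
          gcongr
          · exact hS0 _
          · exact hS p1 h0 hlt.le
          · exact hl ⟨p1, l1⟩ ⟨h0, h1⟩ hlt.le
  · filter_upwards [hbound] with σ ⟨h0, h1, hN1⟩
    obtain ⟨hlt, hle⟩ := hNσ σ h0 h1
    have p0 := scaleSeq_pos (N σ)
    have p1 := scaleSeq_pos (N σ + 1)
    have l0 := scaleSeq_lt_one hN1
    have q0 := hl0 σ ⟨h0, h1⟩
    have q1 := hl0 _ ⟨p0, l0⟩
    simp only [Function.comp_apply]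
    calc S σ / (σ ^ 2 * l σ)
        ≤ S (scaleSeq (N σ)) / (scaleSeq (N σ + 1) ^ 2 * l (scaleSeq (N σ))) := by
          gcongr
          · exact hS0 _
          · exact hS h0 p0 hle
          · exact hl ⟨h0, h1⟩ ⟨p0, l0⟩ hle
      _ = _ := by field_simp

theorem monotoneOn_approxSelfIntersections {Ω : Type*} [MeasurableSpace Ω] {d : ℕ}
    {B : unitInterval → Ω → EuclideanSpace ℝ (Fin d)} (hBm : Measurable (Function.uncurry B))
    (ω : Ω) : MonotoneOn (fun σ => approxSelfIntersections B σ ω) (Set.Ioi 0) := by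
  intro σ hσ τ hτ hστ
  have hσ0 : 0 < σ := hσ
  simp only [approxSelfIntersections_eq_integral_prod hBm]
  have hint : ∀ σ : ℝ, Integrable fun q : unitInterval × unitInterval =>
      gaussKernel σ (B q.1 ω - B q.2 ω) := fun σ =>
    Integrable.of_bound (measurable_gaussKernel_sub hBm σ).of_uncurry_right.aestronglyMeasurable 1
      (Eventually.of_forall fun q => by
        rw [Real.norm_of_nonneg (gaussKernel_pos _ _).le]
        exact gaussKernel_le_one _ _)
  refine integral_mono (hint σ) (hint τ) fun q => ?_
  simp only [gaussKernel, Real.exp_le_exp, neg_div, neg_le_neg_iff]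
  gcongr

theorem memLp_approxSelfIntersections {Ω : Type*} [MeasurableSpace Ω] {P : Measure Ω}
    [IsFiniteMeasure P] {d : ℕ} {B : unitInterval → Ω → EuclideanSpace ℝ (Fin d)}
    (hBm : Measurable (Function.uncurry B)) (σ : ℝ) :
    MemLp (approxSelfIntersections B σ) 2 P := by
  have hm : Measurable (approxSelfIntersections B σ) := by
    simp_rw [funext fun ω => approxSelfIntersections_eq_integral_prod hBm σ ω]
    exact ((measurable_gaussKernel_sub hBm σ).comp
      measurable_swap).stronglyMeasurable.integral_prod_right'.measurable
  refine MemLp.of_bound hm.aestronglyMeasurable 1 (Eventually.of_forall fun ω => ?_)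
  rw [approxSelfIntersections_eq_integral_prod hBm]
  refine (norm_integral_le_of_norm_le_const (C := 1) (Eventually.of_forall fun q => ?_)).trans ?_
  · rw [Real.norm_of_nonneg (gaussKernel_pos _ _).le]
    exact gaussKernel_le_one _ _
  · rw [Measure.volume_eq_prod]
    simp

theorem approxSelfIntersections_nonneg {Ω : Type*} {d : ℕ}
    (B : unitInterval → Ω → EuclideanSpace ℝ (Fin d)) (σ : ℝ) (ω : Ω) :
    0 ≤ approxSelfIntersections B σ ω :=
  integral_nonneg fun _ => integral_nonneg fun _ => (gaussKernel_pos _ _).le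

theorem IsStandardBrownianMotion.ae_tendsto_approxSelfIntersections_div {Ω : Type*}
    [MeasurableSpace Ω] {P : Measure Ω} [IsProbabilityMeasure P] {d : ℕ}
    {B : unitInterval → Ω → EuclideanSpace ℝ (Fin d)} (hB : IsStandardBrownianMotion B P)
    (hd : 2 ≤ d) {l : ℝ → ℝ} {L β C : ℝ} (hβ0 : 0 ≤ β) (hβ1 : β < 1)
    (hβ : β ≤ ((d : ℝ) / 2 + 1) / 3)
    (hl : AntitoneOn l (Set.Ioo 0 1)) (hl0 : ∀ σ ∈ Set.Ioo (0 : ℝ) 1, 0 < l σ)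
    (hmean : Tendsto (fun σ : ℝ => meanSelfIntersections (σ ^ 2) (d / 2) / (σ ^ 2 * l σ))
      (𝓝[>] 0) (𝓝 L))
    (hvar : ∀ σ ∈ Set.Ioo (0 : ℝ) 1,
      ((σ ^ 2) ^ β) ^ 3 / (σ ^ 2 * l σ) ^ 2 ≤ C / Real.log (1 / σ) ^ 2) :
    ∀ᵐ ω ∂P, Tendsto (fun σ : ℝ => approxSelfIntersections B σ ω / (σ ^ 2 * l σ))
      (𝓝[>] 0) (𝓝 L) := by
  obtain ⟨B', hB', hBm, hver⟩ := hB.exists_measurable_version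
  have hsub : ∀ᵐ ω ∂P, Tendsto (fun n => (approxSelfIntersections B' (scaleSeq (n + 1)) ω -
      meanSelfIntersections (scaleSeq (n + 1) ^ 2) (d / 2)) /
        (scaleSeq (n + 1) ^ 2 * l (scaleSeq (n + 1)))) atTop (𝓝 0) := by
    refine ae_tendsto_zero_of_summable_integral_sq
      -- The variance constant times `C / log²`, where `log(1/σ_(n+1)) = (n+1)^(2/3)`.
      (b := fun n => d * (2 / (1 - β)) ^ 3 * C * (1 / ((n + 1 : ℕ) : ℝ) ^ (4 / 3 : ℝ)))
      (fun n => ?_) ?_ fun n => ?_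
    · have := ((memLp_approxSelfIntersections (P := P) hBm (scaleSeq (n + 1))).sub
        (memLp_const (meanSelfIntersections (scaleSeq (n + 1) ^ 2) (d / 2)))).mul_const
        ((scaleSeq (n + 1) ^ 2 * l (scaleSeq (n + 1)))⁻¹)
      exact this
    · exact ((summable_nat_add_iff 1).2
        (Real.summable_one_div_nat_rpow.2 (by norm_num : (1 : ℝ) < 4 / 3))).mul_left _
    · set σ := scaleSeq (n + 1) with hσ
      have hσ0 : 0 < σ := scaleSeq_pos _
      have hσ1 : σ < 1 := scaleSeq_lt_one (by omega)
      have hv := hvar σ ⟨hσ0, hσ1⟩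
      have hlog : Real.log (1 / σ) ^ 2 = ((n + 1 : ℕ) : ℝ) ^ (4 / 3 : ℝ) := by
        rw [hσ, log_one_div_scaleSeq, ← Real.rpow_mul_natCast (by positivity)]
        norm_num
      rw [hlog] at hv
      simp_rw [div_pow]
      rw [integral_div]
      have h1 : 0 < 1 - β := by linarith
      calc _ ≤ d * (2 / (1 - β) * (σ ^ 2) ^ β) ^ 3 / (σ ^ 2 * l σ) ^ 2 := by
            gcongr
            exact hB'.integral_sq_approxSelfIntersections_sub_le hBm hd hσ0 hβ0 hβ1 hβ
        _ = d * (2 / (1 - β)) ^ 3 * (((σ ^ 2) ^ β) ^ 3 / (σ ^ 2 * l σ) ^ 2) := by ring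
        _ ≤ d * (2 / (1 - β)) ^ 3 * (C / ((n + 1 : ℕ) : ℝ) ^ (4 / 3 : ℝ)) :=
            mul_le_mul_of_nonneg_left hv (by positivity)
        _ = _ := by rw [mul_assoc _ C, mul_one_div, div_pow]
  have hmean' := (hmean.comp tendsto_scaleSeq).comp (tendsto_add_atTop_nat 1)
  filter_upwards [hsub, hver] with ω h1 h2
  have h3 : ∀ σ, approxSelfIntersections B σ ω = approxSelfIntersections B' σ ω := fun σ => by
    simp only [approxSelfIntersections, h2]
  simp_rw [h3]
  refine tendsto_div_sq_mul_of_tendsto_scaleSeq (monotoneOn_approxSelfIntersections hBm ω)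
    (fun σ => approxSelfIntersections_nonneg B' σ ω) hl hl0 ?_
  rw [← tendsto_add_atTop_iff_nat 1]
  have h4 := h1.add hmean'
  rw [zero_add] at h4
  refine h4.congr fun n => ?_
  simp only [Function.comp_apply]
  rw [← add_div, sub_add_cancel]

/-! ### The two dimension regimes -/

theorem mainTheorem3 {Ω : Type*} [MeasurableSpace Ω] (P : Measure Ω) [IsProbabilityMeasure P]
    (d : ℕ) (B : unitInterval → Ω → EuclideanSpace ℝ (Fin d))
    (hB : IsStandardBrownianMotion B P) :
    (3 ≤ d → ∀ᵐ ω ∂P,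
      Tendsto (fun σ : ℝ => approxSelfIntersections B σ ω / σ ^ 2)
        (𝓝[>] 0) (𝓝 (4 / ((d : ℝ) - 2)))) ∧
    (d = 2 → ∀ᵐ ω ∂P,
      Tendsto (fun σ : ℝ => approxSelfIntersections B σ ω / (σ ^ 2 * Real.log (1 / σ)))
        (𝓝[>] 0) (𝓝 4)) := by
  have hlogpos : ∀ σ ∈ Set.Ioo (0 : ℝ) 1, 0 < Real.log (1 / σ) := fun σ hσ =>
    Real.log_pos (by rw [lt_div_iff₀ hσ.1]; linarith [hσ.2])
  refine ⟨fun hd => ?_, fun hd => ?_⟩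
  · have hd' : (3 : ℝ) ≤ d := by exact_mod_cast hd
    have hsq : Tendsto (fun σ : ℝ => σ ^ 2) (𝓝[>] 0) (𝓝[>] 0) := by
      refine tendsto_nhdsWithin_iff.2 ⟨?_, ?_⟩
      · have : ContinuousAt (fun σ : ℝ => σ ^ 2) 0 := by fun_prop
        simpa using this.tendsto.mono_left nhdsWithin_le_nhds
      · filter_upwards [self_mem_nhdsWithin] with σ hσ
        exact pow_pos (Set.mem_Ioi.1 hσ) 2
    have hmean := (tendsto_meanSelfIntersections_div
      (p := (d : ℝ) / 2) (by linarith)).comp hsq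
    rw [show 2 / ((d : ℝ) / 2 - 1) = 4 / ((d : ℝ) - 2) by
      have : (d : ℝ) - 2 ≠ 0 := by linarith
      have : (d : ℝ) / 2 - 1 ≠ 0 := by linarith
      field_simp; ring] at hmean
    -- `5/6` is the value of `(d/2 + 1)/3` at `d = 3`, thus admissible for all `d ≥ 3`. The relative
    -- variance is then of order `σ`, and `C = 2` comes from `exp L ≥ 1 + L + L²/2` with `L =
    -- log(1/σ)`.
    have := hB.ae_tendsto_approxSelfIntersections_div (by omega) (l := fun _ => 1) (β := 5 / 6)
      (C := 2) (L := 4 / ((d : ℝ) - 2)) (by norm_num) (by norm_num) (by linarith)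
      antitoneOn_const (fun _ _ => one_pos) (by simpa [Function.comp_def] using hmean) ?_
    · simpa using this
    · intro σ hσ
      have h0 : 0 < σ := hσ.1
      have hL := hlogpos σ hσ
      have h1 : ((σ ^ 2) ^ (5 / 6 : ℝ)) ^ 3 / (σ ^ 2 * 1) ^ 2 = σ := by
        rw [← Real.rpow_mul_natCast (by positivity), ← Real.rpow_natCast_mul h0.le, mul_one,
          ← pow_mul, div_eq_iff (by positivity), ← pow_succ', ← Real.rpow_natCast]
        norm_num
      rw [h1, le_div_iff₀ (by positivity)]
      have h2 := Real.quadratic_le_exp_of_nonneg hL.le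
      rw [Real.exp_log (by positivity), le_div_iff₀ h0] at h2
      nlinarith [mul_pos h0 hL]
  · subst hd
    have hmean := tendsto_meanSelfIntersections_one_div
    -- At `d = 2` the largest admissible exponent is `β = 2/3`; then `σ^(6β) = σ⁴` cancels exactly,
    -- leaving `1/log²`.
    refine hB.ae_tendsto_approxSelfIntersections_div le_rfl (l := fun σ => Real.log (1 / σ))
      (β := 2 / 3) (C := 1) (by norm_num) (by norm_num) (by norm_num) ?_ hlogpos
      (by simpa using hmean) ?_
    · intro σ hσ τ hτ hστ
      have h0 : 0 < σ := hσ.1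
      have h1 : 0 < τ := hτ.1
      exact Real.log_le_log (by positivity) (one_div_le_one_div_of_le h0 hστ)
    · intro σ hσ
      have h0 : 0 < σ := hσ.1
      have hL := hlogpos σ hσ
      have h1 : ((σ ^ 2) ^ (2 / 3 : ℝ)) ^ 3 = (σ ^ 2) ^ 2 := by
        rw [← Real.rpow_mul_natCast (by positivity), ← Real.rpow_natCast]
        norm_num
      rw [h1, mul_pow]
      apply le_of_eq
      field_simp
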